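/- Let $n\ge 2$ and let $C_1,\dots,C_n\subseteq\mathbb R^2$ be mutually disjoint, convex, compact domains (with non-empty interior) with $C^2$ boundaries, such that no line meets three different $C_\ell$. Let $b_1,\dots,b_n\in\mathbb R\setminus\{0\}$, $B=\sum_\ell b_\ell \mathbf 1_{C_\ell}$, $\mathbb J=\begin{pmatrix}0&-1\\1&0\end{pmatrix}$, and consider the motion $\dot q=v$, $\dot v=B(q)\,\mathbb J v$ with $\|v\|=1$ (circular arcs of radius $1/|b_\ell|$ inside $C_\ell$, straight lines outside the bumps). Let $\overline\kappa_\ell$ be the maximal curvature of $\partial C_\ell$ and $d_\ell:=\min_{m\ne\ell}\mathrm{dist}(C_\ell,C_m)>0$. For $n\ge3$ let $\alpha_{\min}$ be the minimum, over pairwise different $k,\ell,m$ and $x\in C_k$, $y\in C_\ell$, $z\in C_m$, of the angle at $y$ of the triangle $x,y,z$; for $n=2$ put $\alpha_{\min}:=\pi/3$. For the unit outward normal $\mathcal N$ of $C_\ell$ let $\mathcal H_\ell^{\pm}:=\{(q,v): q\in\partial C_\ell,\ \|v\|=1,\ \pm\langle v,\mathcal N(q)\rangle>0\}$. The Poincaré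 map $\mathcal P$ is defined on the set $U^-$ of those $x\in\bigcup_\ell\mathcal H_\ell^-$ whose trajectory, after entering $C_\ell$ at $x\in \mathcal H^-_\ell$, leaves $C_\ell$ in a point of $\mathcal H_\ell^+$ and then, following a straight line, meets a bump again and enters the first bump $C_m$ that it meets in a point of $\mathcal H_m^-$, which is denoted by $\mathcal P(x)$. A tangent vector $(\delta q,\delta v)$ of $\mathcal H_\ell^-$ at $x=(q,v)$ is described by its coordinates $(J,\dot J)=(\langle \delta q,\mathbb J v\rangle,\langle\delta v,\mathbb Jv\rangle)$. Let $e^{(l)},e^{(u)}\in T_x\mathcal H_\ell^-$ be the vectors with coordinates $(1,0)$ and $(d_\ell,1)$, and $$\mathcal C_\ell(x):=\{\lambda^{(l)}e^{(l)}+\lambda^{(u)}e^{(u)}\mid \lambda^{(l)},\lambda^{(u)}\in\mathbb R,\ \lambda^{(l)}\lambda^{(u)}>0\}.$$ Assume the very strong fields inequalities $$|b_\ell|>\frac1{d_\ell\,\alpha_{\min}}+2\overline\kappa_\ell\qquad(\ell=1,\dots,n).$$ Then the cone fields $\mathcal C_\ell$ are strictly invariant under the linearized Poincaré map $T\mathcal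 P$. That is, for every $x\in U^-\cap\mathcal H_\ell^-$ with $\mathcal P(x)\in\mathcal H_m^-$, the map $\mathcal P$ is differentiable at $x$, $$T_x\mathcal P\bigl(\mathcal C_\ell(x)\bigr)\subsetneq \mathcal C_m(\mathcal P(x)),$$ and, if $C_\ell$ is strictly convex, even $$T_x\mathcal P\bigl(\overline{\mathcal C_\ell(x)}\setminus\{0\}\bigr)\subseteq \mathcal C_m(\mathcal P(x)).$$ -/

import Mathlib

noncomputable section

/-- The Euclidean plane `ℝ²`. -/
abbrev Plane : Type := EuclideanSpace ℝ (Fin 2)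

/-- Phase space `Tℝ²`, with points `(q, v)`; tangent vectors `(δq, δv)` are taken in the same
vector space. -/
abbrev Phase : Type := Plane × Plane

/-- Rotation by `+π/2`: the matrix `(0, -1; 1, 0)`. -/
def rotJ (v : Plane) : Plane := !₂[-v 1, v 0]

/-- A compact convex domain in the plane with `C²` boundary. The boundary is presented by an
arc-length parametrization of class `C²` which runs once around it counter-clockwise. -/
structure Bump where
  /-- the domain -/
  carrier : Set Plane
  isCompact : IsCompact carrier
  convex : Convex ℝ carrier
  interior_nonempty : (interior carrier).Nonempty
  /-- the boundary curve -/
  bdry : ℝ → Plane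
  /-- the length of the boundary -/
  length : ℝ
  length_pos : 0 < length
  contDiff_bdry : ContDiff ℝ 2 bdry
  periodic_bdry : Function.Periodic bdry length
  injOn_bdry : Set.InjOn bdry (Set.Ico 0 length)
  range_bdry : Set.range bdry = frontier carrier
  norm_deriv_bdry : ∀ s, ‖deriv bdry s‖ = 1
  /-- the domain lies to the left of each oriented tangent line -/
  left_of_tangent : ∀ s, ∀ y ∈ carrier, 0 ≤ inner ℝ (rotJ (deriv bdry s)) (y - bdry s)

namespace Bump

/-- The unit outward normal vector at the boundary point `bdry s`. -/
def normal (C : Bump) (s : ℝ) : Plane := -rotJ (deriv C.bdry s)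

/-- The curvature of the boundary at the point `bdry s` (nonnegative by convexity). -/
def curvature (C : Bump) (s : ℝ) : ℝ :=
  inner ℝ (deriv (deriv C.bdry) s) (rotJ (deriv C.bdry s))

/-- The maximal curvature of the boundary. -/
def maxCurvature (C : Bump) : ℝ := sSup (Set.range C.curvature)

end Bump

/-- The solution at time `t` of `q' = v`, `v' = b J v` (with `b ≠ 0`) with initial value `x`. -/
def larmorFlow (b t : ℝ) (x : Phase) : Phase :=
  (x.1 + b⁻¹ • (Real.sin (b * t) • x.2 + (1 - Real.cos (b * t)) • rotJ x.2),
    Real.cos (b * t) • x.2 + Real.sin (b * t) • rotJ x.2)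

/-- The solution at time `t` of `q' = v`, `v' = 0` with initial value `x`. -/
def freeFlow (t : ℝ) (x : Phase) : Phase := (x.1 + t • x.2, x.2)

/-- `n` mutually disjoint bumps carrying constant magnetic fields of strength `b ℓ ≠ 0`. -/
structure MagneticBumps (n : ℕ) where
  C : Fin n → Bump
  disjoint : ∀ k l, k ≠ l → Disjoint (C k).carrier (C l).carrier
  b : Fin n → ℝ
  b_ne_zero : ∀ l, b l ≠ 0

namespace MagneticBumps

variable {n : ℕ} (S : MagneticBumps n)

/-- `d_ℓ`: the minimal distance of the bump `ℓ` from the other bumps. -/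
def d (l : Fin n) : ℝ :=
  sInf {δ | ∃ m, m ≠ l ∧ ∃ x ∈ (S.C l).carrier, ∃ y ∈ (S.C m).carrier, δ = dist x y}

/-- No line meets three different bumps. -/
def NoThreeOnLine : Prop :=
  ∀ k l m, k ≠ l → l ≠ m → m ≠ k →
    ∀ x ∈ (S.C k).carrier, ∀ y ∈ (S.C l).carrier, ∀ z ∈ (S.C m).carrier,
      ¬ Collinear ℝ ({x, y, z} : Set Plane)

/-- `α_min`: the minimal angle, at `y`, of a triangle `x, y, z` with vertices in three different
bumps; by convention `π / 3` for two bumps. -/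
def alphaMin : ℝ :=
  if n = 2 then Real.pi / 3 else
    sInf {α | ∃ k l m, k ≠ l ∧ l ≠ m ∧ m ≠ k ∧
      ∃ x ∈ (S.C k).carrier, ∃ y ∈ (S.C l).carrier, ∃ z ∈ (S.C m).carrier,
        α = EuclideanGeometry.angle x y z}

/-- The very strong fields inequalities. -/
def VeryStrong : Prop :=
  ∀ l, 1 / (S.d l * S.alphaMin) + 2 * (S.C l).maxCurvature < |S.b l|

/-- `H_ℓ⁺`: unit vectors at boundary points of the bump `ℓ` that point outwards. -/
def Hplus (l : Fin n) : Set Phase :=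
  {x | ‖x.2‖ = 1 ∧ ∃ s, (S.C l).bdry s = x.1 ∧ 0 < inner ℝ x.2 ((S.C l).normal s)}

/-- `H_ℓ⁻`: unit vectors at boundary points of the bump `ℓ` that point inwards. -/
def Hminus (l : Fin n) : Set Phase :=
  {x | ‖x.2‖ = 1 ∧ ∃ s, (S.C l).bdry s = x.1 ∧ inner ℝ x.2 ((S.C l).normal s) < 0}

/-- The time after which a trajectory that enters the bump `ℓ` at `x` is back on its boundary. -/
def exitTime (l : Fin n) (x : Phase) : ℝ :=
  sInf {t | 0 < t ∧ (larmorFlow (S.b l) t x).1 ∈ frontier (S.C l).carrier}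

/-- The Poincaré map internal to the bump `ℓ`. -/
def poincareInt (l : Fin n) (x : Phase) : Phase := larmorFlow (S.b l) (S.exitTime l x) x

/-- The positive times at which the straight trajectory starting at `x` is in some bump. -/
def hitTimes (x : Phase) : Set ℝ := {t | 0 < t ∧ ∃ m, (freeFlow t x).1 ∈ (S.C m).carrier}

/-- The Poincaré map external to the bumps. -/
def poincareExt (x : Phase) : Phase := freeFlow (sInf (S.hitTimes x)) x

/-- The part of the domain `V⁺` of the external Poincaré map that lies in `H_ℓ⁺`: the straight
trajectory meets a bump again, and enters the first bump that it meets transversally. -/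
def Vplus (l : Fin n) : Set Phase :=
  {x | x ∈ S.Hplus l ∧ (S.hitTimes x).Nonempty ∧ ∃ m, S.poincareExt x ∈ S.Hminus m}

/-- The part of the domain `U⁻` of the Poincaré map that lies in `H_ℓ⁻`. -/
def Uminus (l : Fin n) : Set Phase := {x | x ∈ S.Hminus l ∧ S.poincareInt l x ∈ S.Vplus l}

/-- The Poincaré map on the part of its domain in `H_ℓ⁻`. -/
def poincare (l : Fin n) (x : Phase) : Phase := S.poincareExt (S.poincareInt l x)

/-- The tangent space at `x = (q, v)` of the surface `H_ℓ⁻` (locally `{(bdry s, v) | ‖v‖ = 1}`):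
`δq` is tangent to the boundary of the bump and `δv` is tangent to the unit circle. -/
def tangentH (l : Fin n) (x : Phase) : Set Phase :=
  {w | ∃ s a c : ℝ, (S.C l).bdry s = x.1 ∧ w = (a • deriv (S.C l).bdry s, c • rotJ x.2)}

/-- The coordinates `(J, J')` of a tangent vector `(δq, δv)` at `(q, v)`: the components of `δq`
and of `δv` in the direction `J v` orthogonal to the trajectory. -/
def jacobiCoord (x w : Phase) : ℝ × ℝ := (inner ℝ (rotJ x.2) w.1, inner ℝ (rotJ x.2) w.2)

/-- The cone `C_ℓ(x)` in the tangent space of `H_ℓ⁻` at `x`, spanned by the vectors with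
coordinates `e⁽ˡ⁾ = (1, 0)` and `e⁽ᵘ⁾ = (d_ℓ, 1)`. -/
def cone (l : Fin n) (x : Phase) : Set Phase :=
  {w | w ∈ S.tangentH l x ∧ ∃ p r : ℝ, 0 < p * r ∧
    jacobiCoord x w = p • ((1, 0) : ℝ × ℝ) + r • ((S.d l, 1) : ℝ × ℝ)}

end MagneticBumps

end

noncomputable section

open Filter Topology Set

/-! In the bases `(1, 0)`, `(d, 1)` of the tangent planes at entry and at re-entry, the linearized
Poincaré map is minus a matrix with rows `x₁, x₂` and `y₁, y₂`, where `x₁, x₂, y₂ > 0`, `y₁ ≥ 0` and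
the determinant is positive (`exists_matrix`). Such a matrix maps the double cone of vectors with
coefficients of equal sign into itself. The image is proper because the image of the upper edge
bounds it inside the cone. For a strictly convex bump `y₁ > 0`, so the closed cone without its apex
also enters the open cone.

The entries come from differentiating the entry, exit and re-entry conditions along a curve of
initial values (`poincare_deriv`). They are expressed by half the turning angle `a` inside the bump
and the angles `ω₁`, `ω₂` between the chord and the boundary at entry and exit. Comparison with
inscribed disks gives `sin ωᵢ ≤ (κ / |b|) sin a` (`two_mul_height_le`, `chord_angles`), with `κ /
|b| < 1/2`; hence both `ωᵢ` are acute and `sin (a - ωᵢ) > 0`, which settles every sign except that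
of `x₂`.

The minimal angle enters only through `α_min ≤ π / 3`, the angle sum of a triangle. The strong field
condition then says `d (|b| - 2κ) > 3 / π > 0.954`. This alone does not make the contribution of the
bump to `x₂` positive. In the narrow range where that contribution is negative, the trajectory
leaves the bump obliquely; since a disk of twice the Larmor radius touches the exit point from
inside, the flight is longer than the distance between the bumps by a definite amount, and the
surplus compensates (`flight_estimate`, `cone_estimate`). -/

/-! ### Rotation and inner products in the plane -/

theorem Plane.inner_eq (u v : Plane) : inner ℝ u v = u 0 * v 0 + u 1 * v 1 := by
  simp [PiLp.inner_apply, Fin.sum_univ_two, mul_comm]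

theorem Plane.norm_sq_eq (u : Plane) : ‖u‖ ^ 2 = u 0 ^ 2 + u 1 ^ 2 := by
  rw [← real_inner_self_eq_norm_sq, Plane.inner_eq]; ring

theorem Plane.ext' {u v : Plane} (h0 : u 0 = v 0) (h1 : u 1 = v 1) : u = v := by
  ext i; fin_cases i <;> assumption

@[simp] theorem rotJ_apply_zero (v : Plane) : rotJ v 0 = -v 1 := rfl
@[simp] theorem rotJ_apply_one (v : Plane) : rotJ v 1 = v 0 := rfl

/-- The rotation by `π / 2` as a continuous linear map. -/
def rotL : Plane →L[ℝ] Plane :=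
  LinearMap.toContinuousLinearMap
    { toFun := rotJ
      map_add' := fun u v => Plane.ext' (by simp; ring) (by simp)
      map_smul' := fun c v => Plane.ext' (by simp) (by simp) }

@[simp] theorem rotL_apply (v : Plane) : rotL v = rotJ v := rfl

theorem rotJ_add (u v : Plane) : rotJ (u + v) = rotJ u + rotJ v := rotL.map_add u v
theorem rotJ_sub (u v : Plane) : rotJ (u - v) = rotJ u - rotJ v := rotL.map_sub u v
theorem rotJ_smul (c : ℝ) (v : Plane) : rotJ (c • v) = c • rotJ v := rotL.map_smul c v
theorem rotJ_neg (v : Plane) : rotJ (-v) = -rotJ v := rotL.map_neg v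
theorem rotJ_rotJ (v : Plane) : rotJ (rotJ v) = -v := Plane.ext' (by simp) (by simp)
theorem continuous_rotJ : Continuous rotJ := rotL.continuous

theorem norm_rotJ (v : Plane) : ‖rotJ v‖ = ‖v‖ := by
  have : ‖rotJ v‖ ^ 2 = ‖v‖ ^ 2 := by
    rw [Plane.norm_sq_eq, Plane.norm_sq_eq]; simp [add_comm]
  exact (sq_eq_sq₀ (norm_nonneg _) (norm_nonneg _)).1 this

theorem inner_rotJ_rotJ (u v : Plane) : inner ℝ (rotJ u) (rotJ v) = inner ℝ u v := by
  simp only [Plane.inner_eq, rotJ_apply_zero, rotJ_apply_one]; ring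

theorem inner_rotJ_self (u : Plane) : inner ℝ (rotJ u) u = 0 := by
  rw [Plane.inner_eq, rotJ_apply_zero, rotJ_apply_one]; ring

theorem inner_rotJ_left (u v : Plane) : inner ℝ (rotJ u) v = -inner ℝ u (rotJ v) := by
  simp only [Plane.inner_eq, rotJ_apply_zero, rotJ_apply_one]; ring

/-- Two unit vectors in the plane whose mutual cross product vanishes agree up to sign. -/
theorem eq_or_eq_neg_of_cross {u v : Plane} (hu : ‖u‖ = 1) (hv : ‖v‖ = 1)
    (h : inner ℝ (rotJ u) v = 0) : v = u ∨ v = -u := by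
  have hu' := Plane.norm_sq_eq u
  have hv' := Plane.norm_sq_eq v
  rw [hu] at hu'; rw [hv] at hv'
  simp only [Plane.inner_eq, rotJ_apply_zero, rotJ_apply_one] at h
  have key : (u 0 * v 0 + u 1 * v 1 - 1) * (u 0 * v 0 + u 1 * v 1 + 1) = 0 := by
    linear_combination (-(u 0 * v 1) + u 1 * v 0) * h - (v 0 ^ 2 + v 1 ^ 2) * hu' - hv'
  have e0 : v 0 = (u 0 * v 0 + u 1 * v 1) * u 0 := by
    linear_combination v 0 * hu' + u 1 * (-1) * h
  have e1 : v 1 = (u 0 * v 0 + u 1 * v 1) * u 1 := by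
    linear_combination v 1 * hu' + u 0 * h
  rcases mul_eq_zero.1 key with h1 | h1
  · left
    have : u 0 * v 0 + u 1 * v 1 = 1 := by linarith
    rw [this] at e0 e1
    exact Plane.ext' (by linarith) (by linarith)
  · right
    have : u 0 * v 0 + u 1 * v 1 = -1 := by linarith
    rw [this] at e0 e1
    exact Plane.ext' (by simp; linarith) (by simp; linarith)

/-! ### Convex domains as intersections of tangent half-planes -/

namespace Bump

variable (C : Bump)

/-- The unit tangent vector of the boundary. -/
def tangent (s : ℝ) : Plane := deriv C.bdry s

/-- The signed distance of a point from the oriented tangent line at `bdry s`. -/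
def height (s : ℝ) (y : Plane) : ℝ := inner ℝ (rotJ (C.tangent s)) (y - C.bdry s)

theorem normal_eq (s : ℝ) : C.normal s = -rotJ (C.tangent s) := rfl

theorem norm_tangent (s : ℝ) : ‖C.tangent s‖ = 1 := C.norm_deriv_bdry s

theorem contDiff_tangent : ContDiff ℝ 1 C.tangent := by
  have h : ContDiff ℝ (1 + 1) C.bdry := by
    have := C.contDiff_bdry
    norm_num at this ⊢
    exact this
  exact (contDiff_succ_iff_deriv.1 h).2.2

theorem continuous_tangent : Continuous C.tangent := C.contDiff_tangent.continuous

theorem continuous_bdry : Continuous C.bdry := C.contDiff_bdry.continuous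

theorem hasDerivAt_bdry (s : ℝ) : HasDerivAt C.bdry (C.tangent s) s :=
  (C.contDiff_bdry.differentiable (by norm_num) s).hasDerivAt

theorem periodic_tangent : Function.Periodic C.tangent C.length := fun s => by
  have : (fun x => C.bdry (x + C.length)) = C.bdry := funext C.periodic_bdry
  have h := deriv_comp_add_const C.bdry C.length s
  rw [this] at h
  exact h.symm

theorem continuous_normal : Continuous fun s => rotJ (C.tangent s) :=
  continuous_rotJ.comp C.continuous_tangent

theorem continuous_height : Continuous fun p : ℝ × Plane => C.height p.1 p.2 := by
  unfold height
  exact ((continuous_rotJ.comp (C.continuous_tangent.comp continuous_fst))).inner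
    (continuous_snd.sub (C.continuous_bdry.comp continuous_fst))

theorem height_add_smul (s t : ℝ) (y u : Plane) :
    C.height s (y + t • u) = C.height s y + t * inner ℝ (rotJ (C.tangent s)) u := by
  unfold height
  rw [show y + t • u - C.bdry s = (y - C.bdry s) + t • u by abel, inner_add_right,
    real_inner_smul_right]

theorem isClosed_carrier : IsClosed C.carrier := C.isCompact.isClosed

theorem bdry_mem_frontier (s : ℝ) : C.bdry s ∈ frontier C.carrier :=
  C.range_bdry ▸ mem_range_self s

theorem bdry_mem (s : ℝ) : C.bdry s ∈ C.carrier :=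
  C.isClosed_carrier.frontier_subset (C.bdry_mem_frontier s)

theorem height_nonneg {y : Plane} (hy : y ∈ C.carrier) (s : ℝ) : 0 ≤ C.height s y :=
  C.left_of_tangent s y hy

theorem height_bdry_self (s : ℝ) : C.height s (C.bdry s) = 0 := by simp [height]

theorem inner_normal_self (s : ℝ) : inner ℝ (rotJ (C.tangent s)) (rotJ (C.tangent s)) = 1 := by
  rw [real_inner_self_eq_norm_sq, norm_rotJ, C.norm_tangent]; norm_num

/-- A small step from an interior point along the outer normal stays in the domain, where the height
is nonnegative, although the step has lowered the height. -/
theorem height_pos_of_mem_interior {y : Plane} (hy : y ∈ interior C.carrier) (s : ℝ) :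
    0 < C.height s y := by
  have hc : Continuous fun t : ℝ => y + t • (-rotJ (C.tangent s)) := by fun_prop
  have h0 : ∀ᶠ t : ℝ in 𝓝 0, y + t • (-rotJ (C.tangent s)) ∈ interior C.carrier := by
    apply hc.continuousAt.eventually_mem
    simpa using isOpen_interior.mem_nhds hy
  obtain ⟨ε, hε, h⟩ := Metric.eventually_nhds_iff.1 h0
  have h1 := h (y := ε / 2) (by rw [dist_zero_right, Real.norm_of_nonneg] <;> linarith)
  have h2 := C.height_nonneg (interior_subset h1) s
  rw [height_add_smul, inner_neg_right, inner_normal_self] at h2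
  linarith

/-- The segment from an interior point `z` to `y` meets the boundary, and the tangent line there
separates: the height is affine along the segment, positive at `z` and zero at the crossing. This
gives the domain and its interior as intersections of half-planes. -/
theorem exists_height_nonpos {y : Plane} (hy : y ∉ interior C.carrier) :
    ∃ s, C.height s y ≤ 0 ∧ (y ∉ C.carrier → C.height s y < 0) := by
  obtain ⟨z, hz⟩ := C.interior_nonempty
  have hp : IsPreconnected (segment ℝ z y) := (convex_segment z y).isPreconnected
  have h1 : (segment ℝ z y ∩ interior C.carrier).Nonempty := ⟨z, left_mem_segment ℝ z y, hz⟩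
  have h2 : (segment ℝ z y ∩ (interior C.carrier)ᶜ).Nonempty := ⟨y, right_mem_segment ℝ z y, hy⟩
  have h3 : (segment ℝ z y ∩ frontier C.carrier).Nonempty := by
    by_contra hne
    have hsub : segment ℝ z y ⊆ interior C.carrier ∪ C.carrierᶜ := by
      intro p hp'
      by_cases hpC : p ∈ C.carrier
      · left
        by_contra hpi
        exact hne ⟨p, hp', by
          rw [C.isClosed_carrier.frontier_eq]; exact ⟨hpC, hpi⟩⟩
      · exact Or.inr hpC
    by_cases hyC : y ∈ C.carrier
    · exact hne ⟨y, right_mem_segment ℝ z y, by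
        rw [C.isClosed_carrier.frontier_eq]; exact ⟨hyC, hy⟩⟩
    · obtain ⟨p, -, hp1, hp2⟩ := hp _ _ isOpen_interior C.isClosed_carrier.isOpen_compl hsub h1
        ⟨y, right_mem_segment ℝ z y, hyC⟩
      exact hp2 (interior_subset hp1)
  obtain ⟨p, hpseg, hpf⟩ := h3
  rw [← C.range_bdry] at hpf
  obtain ⟨s, rfl⟩ := hpf
  rw [segment_eq_image'] at hpseg
  obtain ⟨r, ⟨hr0, hr1⟩, hr⟩ := hpseg
  simp only at hr
  have hzs := C.height_pos_of_mem_interior hz s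
  have e1 : C.height s z + r * inner ℝ (rotJ (C.tangent s)) (y - z) = 0 := by
    rw [← height_add_smul, hr, height_bdry_self]
  have e2 : C.height s y = C.height s z + 1 * inner ℝ (rotJ (C.tangent s)) (y - z) := by
    rw [← height_add_smul]; congr 1; simp
  refine ⟨s, ?_, fun hyC => ?_⟩
  · by_contra hcon
    push Not at hcon
    have h4 : (1 - r) * C.height s z + r * C.height s y = 0 := by rw [e2]; linarith
    have h5 := mul_nonneg (sub_nonneg.2 hr1) hzs.le
    rcases hr0.eq_or_lt with h0 | h0
    · subst h0; linarith
    · have := mul_pos h0 hcon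
      linarith
  · have hr1' : r ≠ 1 := by
      rintro rfl
      apply hyC
      have : y = C.bdry s := by rw [← hr]; simp
      rw [this]; exact C.bdry_mem s
    have : r < 1 := lt_of_le_of_ne hr1 hr1'
    by_contra hcon
    push Not at hcon
    nlinarith

theorem mem_interior_of_height_pos {y : Plane} (h : ∀ s, 0 < C.height s y) :
    y ∈ interior C.carrier := by
  by_contra hy
  obtain ⟨s, hs, -⟩ := C.exists_height_nonpos hy
  exact absurd (h s) (not_lt.2 hs)

theorem mem_of_height_nonneg {y : Plane} (h : ∀ s, 0 ≤ C.height s y) : y ∈ C.carrier := by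
  by_contra hy
  obtain ⟨s, -, hs⟩ := C.exists_height_nonpos (fun h' => hy (interior_subset h'))
  exact absurd (h s) (not_le.2 (hs hy))

theorem hasDerivAt_height_bdry (s u : ℝ) :
    HasDerivAt (fun u => C.height s (C.bdry u)) (inner ℝ (rotJ (C.tangent s)) (C.tangent u)) u := by
  have h1 : HasDerivAt (fun u => C.bdry u - C.bdry s) (C.tangent u) u :=
    (C.hasDerivAt_bdry u).sub_const _
  have := (hasDerivAt_const u (rotJ (C.tangent s))).inner ℝ h1
  simpa [height] using this

/-- The height above a tangent line is nonnegative along the boundary, so a zero is a minimum and a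
critical point. -/
theorem inner_normal_tangent_eq_zero {s s₀ : ℝ} (h : C.height s (C.bdry s₀) = 0) :
    inner ℝ (rotJ (C.tangent s)) (C.tangent s₀) = 0 := by
  have hmin : IsLocalMin (fun u => C.height s (C.bdry u)) s₀ :=
    Eventually.of_forall fun u => by
      simp only [h]; exact C.height_nonneg (C.bdry_mem u) s
  exact hmin.hasDerivAt_eq_zero (C.hasDerivAt_height_bdry s s₀)

/-- A boundary point on the tangent line at `bdry s` has the same oriented tangent line. -/
theorem tangent_eq_of_height_eq_zero {s s₀ : ℝ} (h : C.height s (C.bdry s₀) = 0) :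
    C.tangent s = C.tangent s₀ := by
  rcases eq_or_eq_neg_of_cross (C.norm_tangent s) (C.norm_tangent s₀)
    (C.inner_normal_tangent_eq_zero h) with h1 | h1
  · exact h1.symm
  · exfalso
    -- With opposite tangents on one line, the two half-planes would be complementary, yet both
    -- contain an interior point strictly.
    obtain ⟨z, hz⟩ := C.interior_nonempty
    have h2 := C.height_pos_of_mem_interior hz s
    have h3 := C.height_pos_of_mem_interior hz s₀
    have : C.height s₀ z = -(C.height s z - C.height s (C.bdry s₀)) := by
      unfold height
      rw [h1, rotJ_neg, inner_neg_left, ← inner_sub_right]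
      congr 2; abel
    rw [h] at this
    linarith

theorem tangent_eq_of_bdry_eq {s s₀ : ℝ} (h : C.bdry s = C.bdry s₀) :
    C.tangent s = C.tangent s₀ :=
  C.tangent_eq_of_height_eq_zero (by rw [← h, height_bdry_self])

theorem exists_mem_Icc_of_periodic (s : ℝ) :
    ∃ s' ∈ Icc 0 C.length, C.bdry s' = C.bdry s ∧ C.tangent s' = C.tangent s := by
  obtain ⟨y, hy, h⟩ := C.periodic_bdry.exists_mem_Ico₀ C.length_pos s
  exact ⟨y, Ico_subset_Icc_self hy, h.symm, C.tangent_eq_of_bdry_eq h.symm⟩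

theorem continuous_height_add_smul : Continuous fun z : (Plane × Plane × ℝ) × ℝ =>
    C.height z.2 (z.1.1 + z.1.2.2 • z.1.2.1) := by
  have h : Continuous fun z : (Plane × Plane × ℝ) × ℝ => z.1.1 + z.1.2.2 • z.1.2.1 :=
    continuous_fst.fst.add (continuous_fst.snd.snd.smul continuous_fst.snd.fst)
  exact C.continuous_height.comp₂ continuous_snd h

theorem continuous_inner_normal : Continuous fun z : (Plane × Plane × ℝ) × ℝ =>
    (inner ℝ (rotJ (C.tangent z.2)) z.1.2.1 : ℝ) :=
  (C.continuous_normal.comp continuous_snd).inner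
    ((continuous_fst.comp continuous_snd).comp continuous_fst)

/-- Near a boundary point, short steps from points of the domain in directions close to a strictly
inward pointing one lead into the interior. -/
theorem eventually_mem_interior {s₀ : ℝ} {u₀ : Plane}
    (hu : 0 < inner ℝ (rotJ (C.tangent s₀)) u₀) :
    ∀ᶠ p : Plane × Plane × ℝ in 𝓝 (C.bdry s₀, u₀, 0), p.1 ∈ C.carrier → 0 < p.2.2 →
      p.1 + p.2.2 • p.2.1 ∈ interior C.carrier := by
  have key : ∀ᶠ p : Plane × Plane × ℝ in 𝓝 (C.bdry s₀, u₀, 0), ∀ s ∈ Icc 0 C.length,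
      p.1 ∈ C.carrier → 0 < p.2.2 → 0 < C.height s (p.1 + p.2.2 • p.2.1) := by
    apply isCompact_Icc.eventually_forall_of_forall_eventually
    intro s _
    -- A tangent line missing the boundary point stays at positive distance under small
    -- perturbations. One passing through it has the same inner normal there, and the direction
    -- increases the height. Compactness of a period makes this uniform in `s`.
    rcases (C.height_nonneg (C.bdry_mem s₀) s).lt_or_eq with h | h
    · have h' := (C.continuous_height_add_smul.tendsto ((C.bdry s₀, u₀, 0), s)).eventually_const_lt
        (u := 0) (by rwa [zero_smul, add_zero])
      exact h'.mono fun z hz _ _ => hz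
    · have hs := C.tangent_eq_of_height_eq_zero h.symm
      have h' := (C.continuous_inner_normal.tendsto ((C.bdry s₀, u₀, 0), s)).eventually_const_lt
        (u := 0) (by rwa [hs])
      refine h'.mono fun z hz hzC hzt => ?_
      rw [height_add_smul]
      have := C.height_nonneg hzC z.2
      have := mul_pos hzt hz
      linarith
  refine key.mono fun p hp hpC hpt => C.mem_interior_of_height_pos fun s => ?_
  obtain ⟨s', hs', h1, h2⟩ := C.exists_mem_Icc_of_periodic s
  have := hp s' hs' hpC hpt
  simpa only [height, h1, h2] using this

end Bump

/-! ### Curvature, turning of the tangent, and inscribed disks -/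

namespace Bump

variable (C : Bump)

theorem curvature_eq (s : ℝ) :
    C.curvature s = inner ℝ (deriv C.tangent s) (rotJ (C.tangent s)) := rfl

theorem continuous_curvature : Continuous C.curvature :=
  (C.contDiff_tangent.continuous_deriv le_rfl).inner C.continuous_normal

theorem hasDerivAt_tangent (s : ℝ) :
    HasDerivAt C.tangent (C.curvature s • rotJ (C.tangent s)) s := by
  have hd : HasDerivAt C.tangent (deriv C.tangent s) s :=
    (C.contDiff_tangent.differentiable (by norm_num) s).hasDerivAt
  have h1 := hd.inner ℝ hd
  have h2 : (fun t => inner ℝ (C.tangent t) (C.tangent t)) = fun _ => (1 : ℝ) := by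
    ext t; rw [real_inner_self_eq_norm_sq, C.norm_tangent]; norm_num
  rw [h2] at h1
  have h3 := h1.unique (hasDerivAt_const s (1 : ℝ))
  have hn := Plane.norm_sq_eq (C.tangent s)
  rw [C.norm_tangent] at hn
  have key : deriv C.tangent s = C.curvature s • rotJ (C.tangent s) := by
    rw [curvature_eq]
    simp only [Plane.inner_eq, rotJ_apply_zero, rotJ_apply_one] at h3 ⊢
    apply Plane.ext'
    · simp only [PiLp.smul_apply, smul_eq_mul, rotJ_apply_zero]
      linear_combination deriv C.tangent s 0 * hn + C.tangent s 0 * h3 / 2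
    · simp only [PiLp.smul_apply, smul_eq_mul, rotJ_apply_one]
      linear_combination deriv C.tangent s 1 * hn + C.tangent s 1 * h3 / 2
  rwa [← key]

theorem hasDerivAt_normal (s : ℝ) :
    HasDerivAt (fun s => rotJ (C.tangent s)) (-C.curvature s • C.tangent s) s := by
  have := rotL.hasFDerivAt.comp_hasDerivAt s (C.hasDerivAt_tangent s)
  simpa [Function.comp_def, rotJ_smul, rotJ_rotJ] using this

/-- The height above the tangent line at `s` is nonnegative along the boundary, zero at `s`, and has
second derivative equal to the curvature there. Negative curvature would make `s` a local maximum
too, so the height would vanish near `s` together with its second derivative. -/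
theorem curvature_nonneg (s : ℝ) : 0 ≤ C.curvature s := by
  by_contra hneg
  push Not at hneg
  set g := fun u => C.height s (C.bdry u) with hg
  have hg' : deriv g = fun u => inner ℝ (rotJ (C.tangent s)) (C.tangent u) :=
    funext fun u => (C.hasDerivAt_height_bdry s u).deriv
  have hg'' : HasDerivAt (deriv g) (C.curvature s) s := by
    rw [hg']
    have := (hasDerivAt_const s (rotJ (C.tangent s))).inner ℝ (C.hasDerivAt_tangent s)
    refine this.congr_deriv ?_
    rw [inner_zero_left, add_zero, real_inner_smul_right, inner_normal_self, mul_one]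
  have h0 : deriv g s = 0 := by rw [hg']; exact inner_rotJ_self _
  have hmax := isLocalMax_of_deriv_deriv_neg (by rwa [hg''.deriv]) h0
    (C.hasDerivAt_height_bdry s s).continuousAt
  have hz : g =ᶠ[𝓝 s] fun _ => 0 := hmax.mono fun u hu =>
    le_antisymm (by simpa [hg, C.height_bdry_self] using hu) (C.height_nonneg (C.bdry_mem u) s)
  have h2 := hz.deriv.deriv_eq
  rw [hg''.deriv] at h2
  simp at h2
  linarith

/-- The angle by which the tangent turns from the parameter `0` to `s`. -/
def turning (s : ℝ) : ℝ := ∫ u in (0 : ℝ)..s, C.curvature u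

theorem hasDerivAt_turning (s : ℝ) : HasDerivAt C.turning (C.curvature s) s :=
  intervalIntegral.integral_hasDerivAt_right (C.continuous_curvature.intervalIntegrable _ _)
    (C.continuous_curvature.stronglyMeasurableAtFilter _ _) C.continuous_curvature.continuousAt

theorem continuous_turning : Continuous C.turning :=
  continuous_iff_continuousAt.2 fun s => (C.hasDerivAt_turning s).continuousAt

theorem monotone_turning : Monotone C.turning :=
  monotone_of_deriv_nonneg (fun s => (C.hasDerivAt_turning s).differentiableAt)
    fun s => by rw [(C.hasDerivAt_turning s).deriv]; exact C.curvature_nonneg s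

theorem tangent_eq (s : ℝ) : C.tangent s =
    Real.cos (C.turning s) • C.tangent 0 + Real.sin (C.turning s) • rotJ (C.tangent 0) := by
  -- The tangent rotated back by the turning angle is constant.
  set W : ℝ → Plane := fun s =>
    Real.cos (C.turning s) • C.tangent s - Real.sin (C.turning s) • rotJ (C.tangent s) with hW
  have hd : ∀ s, HasDerivAt W 0 s := fun s => by
    have h1 := ((C.hasDerivAt_turning s).cos.smul (C.hasDerivAt_tangent s)).sub
      ((C.hasDerivAt_turning s).sin.smul (C.hasDerivAt_normal s))
    refine h1.congr_deriv ?_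
    module
  have hc : W s = W 0 := is_const_of_deriv_eq_zero (fun s => (hd s).differentiableAt)
    (fun s => (hd s).deriv) s 0
  have h0 : W 0 = C.tangent 0 := by simp [hW, turning]
  have : C.tangent s = Real.cos (C.turning s) • W s + Real.sin (C.turning s) • rotJ (W s) := by
    simp only [hW, rotJ_sub, rotJ_smul, rotJ_rotJ]
    have h1 := Real.sin_sq_add_cos_sq (C.turning s)
    calc C.tangent s = (Real.sin (C.turning s) ^ 2 + Real.cos (C.turning s) ^ 2) • C.tangent s := by
          rw [h1, one_smul]
      _ = _ := by module
  rw [this, hc, h0]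

theorem inner_normal_tangent (s u : ℝ) :
    inner ℝ (rotJ (C.tangent s)) (C.tangent u) = Real.sin (C.turning u - C.turning s) := by
  have hn := Plane.norm_sq_eq (C.tangent 0)
  rw [C.norm_tangent] at hn
  rw [C.tangent_eq s, C.tangent_eq u, Real.sin_sub]
  simp only [Plane.inner_eq, rotJ_apply_zero, rotJ_apply_one, PiLp.add_apply, PiLp.smul_apply,
    smul_eq_mul]
  linear_combination (-(Real.sin (C.turning u) * Real.cos (C.turning s)
    - Real.cos (C.turning u) * Real.sin (C.turning s))) * hn

theorem inner_tangent_tangent (s u : ℝ) :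
    inner ℝ (C.tangent s) (C.tangent u) = Real.cos (C.turning u - C.turning s) := by
  have hn := Plane.norm_sq_eq (C.tangent 0)
  rw [C.norm_tangent] at hn
  rw [C.tangent_eq s, C.tangent_eq u, Real.cos_sub]
  simp only [Plane.inner_eq, rotJ_apply_zero, rotJ_apply_one, PiLp.add_apply, PiLp.smul_apply,
    smul_eq_mul]
  linear_combination (-(Real.cos (C.turning u) * Real.cos (C.turning s)
    + Real.sin (C.turning u) * Real.sin (C.turning s))) * hn

theorem tangent_eq_of_cos_eq_one {s u : ℝ} (h : Real.cos (C.turning u - C.turning s) = 1) :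
    C.tangent u = C.tangent s := by
  rw [← C.inner_tangent_tangent] at h
  exact ((inner_eq_one_iff_of_norm_eq_one (C.norm_tangent s) (C.norm_tangent u)).1 h).symm

theorem bdry_ne {u v : ℝ} (h1 : v < u) (h2 : u < v + C.length) : C.bdry u ≠ C.bdry v := by
  intro h
  have hL := C.length_pos
  have e : ∀ w, C.bdry (toIcoMod hL 0 w) = C.bdry w := fun w =>
    C.periodic_bdry.sub_zsmul_eq _
  have hm : ∀ w, toIcoMod hL 0 w ∈ Ico 0 C.length := fun w => by
    simpa using toIcoMod_mem_Ico hL 0 w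
  have h3 : toIcoMod hL 0 u = toIcoMod hL 0 v :=
    C.injOn_bdry (hm u) (hm v) (by rw [e, e, h])
  have h4 : u - v = ((toIcoDiv hL 0 u - toIcoDiv hL 0 v : ℤ) : ℝ) * C.length := by
    have h5 := toIcoMod_add_toIcoDiv_zsmul hL 0 u
    have h6 := toIcoMod_add_toIcoDiv_zsmul hL 0 v
    simp only [zsmul_eq_mul] at h5 h6
    push_cast
    linarith
  set m := toIcoDiv hL 0 u - toIcoDiv hL 0 v
  have h7 : (0 : ℝ) < m := by
    by_contra hcon
    push Not at hcon
    nlinarith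
  have h8 : (m : ℝ) < 1 := by
    by_contra hcon
    push Not at hcon
    nlinarith
  have h9 : 0 < m := by exact_mod_cast h7
  have h10 : m < 1 := by exact_mod_cast h8
  omega

theorem exists_mem_Icc_eq (s u : ℝ) : ∃ u' ∈ Icc s (s + C.length),
    C.bdry u' = C.bdry u ∧ C.tangent u' = C.tangent u := by
  obtain ⟨y, hy, h⟩ := C.periodic_bdry.exists_mem_Ico C.length_pos u s
  exact ⟨y, Ico_subset_Icc_self hy, h.symm, C.tangent_eq_of_bdry_eq h.symm⟩

theorem curvature_periodic : Function.Periodic C.curvature C.length := fun s => by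
  have h1 : (fun x => C.tangent (x + C.length)) = C.tangent := funext C.periodic_tangent
  have h2 := deriv_comp_add_const C.tangent C.length s
  rw [h1] at h2
  rw [curvature_eq, curvature_eq, ← h2, C.periodic_tangent]

theorem turning_add_length (s : ℝ) :
    C.turning (s + C.length) = C.turning s + C.turning C.length := by
  have hd : ∀ s, HasDerivAt (fun s => C.turning (s + C.length) - C.turning s) 0 s := fun s => by
    have := ((C.hasDerivAt_turning (s + C.length)).comp_add_const s C.length).sub
      (C.hasDerivAt_turning s)
    rwa [C.curvature_periodic, sub_self] at this
  have := is_const_of_deriv_eq_zero (fun s => (hd s).differentiableAt) (fun s => (hd s).deriv) s 0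
  have h0 : C.turning 0 = 0 := by simp [turning]
  simp only [zero_add, h0, sub_zero] at this
  linarith

/-- Without turning, the boundary would run along a straight line and could not close up. -/
theorem turning_length_pos : 0 < C.turning C.length := by
  have h0 : C.turning 0 = 0 := by simp [turning]
  have hge := C.monotone_turning C.length_pos.le
  rw [h0] at hge
  refine hge.lt_of_ne' fun hA => ?_
  have hz : ∀ s ∈ Icc 0 C.length, C.tangent s = C.tangent 0 := fun s hs => by
    have h1 := C.monotone_turning hs.1
    have h2 := C.monotone_turning hs.2
    rw [h0] at h1; rw [hA] at h2
    apply C.tangent_eq_of_cos_eq_one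
    rw [h0, le_antisymm h2 h1]; simp
  have hmono : MonotoneOn (fun u => (inner ℝ (C.tangent 0) (C.bdry u) : ℝ) - u)
      (Icc 0 C.length) := by
    have hd : ∀ u, HasDerivAt (fun u => (inner ℝ (C.tangent 0) (C.bdry u) : ℝ) - u)
        (inner ℝ (C.tangent 0) (C.tangent u) - 1) u := fun u => by
      have := ((hasDerivAt_const u (C.tangent 0)).inner ℝ (C.hasDerivAt_bdry u)).fun_sub
        (hasDerivAt_id' u)
      refine this.congr_deriv ?_
      rw [inner_zero_left, add_zero]
    apply monotoneOn_of_deriv_nonneg (convex_Icc _ _)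
      (fun u _ => (hd u).continuousAt.continuousWithinAt)
      (fun u _ => (hd u).differentiableAt.differentiableWithinAt)
    intro u hu
    rw [(hd u).deriv, hz u (interior_subset hu), real_inner_self_eq_norm_sq, C.norm_tangent]
    norm_num
  have h3 := hmono (left_mem_Icc.2 C.length_pos.le) (right_mem_Icc.2 C.length_pos.le)
    C.length_pos.le
  have h4 := C.periodic_bdry 0
  rw [zero_add] at h4
  simp only [h4] at h3
  linarith [C.length_pos]

theorem cos_turning_length : Real.cos (C.turning C.length) = 1 := by
  have h := C.inner_tangent_tangent 0 C.length
  have h4 := C.periodic_tangent 0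
  rw [zero_add] at h4
  have h0 : C.turning 0 = 0 := by simp [turning]
  rw [h4, real_inner_self_eq_norm_sq, C.norm_tangent, h0, sub_zero] at h
  rw [← h]; norm_num

/-- A point of the boundary at which the tangent line meets the domain in a single point. -/
theorem exists_exposed : ∃ s, ∀ u, C.tangent u = C.tangent s → C.bdry u = C.bdry s := by
  obtain ⟨s, -, hs⟩ := isCompact_Icc.exists_isMaxOn (nonempty_Icc.2 C.length_pos.le)
    ((C.continuous_bdry.norm.pow 2).continuousOn (s := Icc 0 C.length))
  have hmax : ∀ u, ‖C.bdry u‖ ^ 2 ≤ ‖C.bdry s‖ ^ 2 := fun u => by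
    obtain ⟨u', hu', h1, -⟩ := C.exists_mem_Icc_of_periodic u
    rw [← h1]; exact hs hu'
  refine ⟨s, fun u hu => ?_⟩
  have hd : HasDerivAt (fun u => ‖C.bdry u‖ ^ 2) (2 * inner ℝ (C.bdry s) (C.tangent s)) s :=
    (C.hasDerivAt_bdry s).norm_sq
  have hcrit : inner ℝ (C.bdry s) (C.tangent s) = (0 : ℝ) := by
    have hl : IsLocalMax (fun u => ‖C.bdry u‖ ^ 2) s := Eventually.of_forall hmax
    have := hl.hasDerivAt_eq_zero hd
    linarith
  have h1 := C.height_nonneg (C.bdry_mem u) s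
  have h2 := C.height_nonneg (C.bdry_mem s) u
  -- The chosen point is farthest from the origin. Equal oriented tangents put both points on one
  -- tangent line, which is perpendicular to the position vector; by Pythagoras any other point of
  -- it is farther away.
  have h3 : C.height s (C.bdry u) = 0 := by
    have : C.height u (C.bdry s) = -C.height s (C.bdry u) := by
      unfold height
      rw [hu, ← inner_neg_right, neg_sub]
    linarith
  have hn := Plane.norm_sq_eq (C.tangent s)
  rw [C.norm_tangent] at hn
  have hM := hmax u
  rw [Plane.norm_sq_eq, Plane.norm_sq_eq] at hM
  simp only [height, Plane.inner_eq, rotJ_apply_zero, rotJ_apply_one, PiLp.sub_apply] at h3 hcrit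
  set x0 := C.bdry u 0
  set x1 := C.bdry u 1
  set y0 := C.bdry s 0
  set y1 := C.bdry s 1
  set t0 := C.tangent s 0
  set t1 := C.tangent s 1
  have e0 : x0 - y0 = ((x0 - y0) * t0 + (x1 - y1) * t1) * t0 := by
    linear_combination (x0 - y0) * hn - t1 * h3
  have e1 : x1 - y1 = ((x0 - y0) * t0 + (x1 - y1) * t1) * t1 := by
    linear_combination (x1 - y1) * hn + t0 * h3
  set c := (x0 - y0) * t0 + (x1 - y1) * t1
  have hc : c ^ 2 ≤ 0 := by
    have a0 : x0 = y0 + c * t0 := by linarith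
    have a1 : x1 = y1 + c * t1 := by linarith
    rw [a0, a1] at hM
    have : (y0 + c * t0) ^ 2 + (y1 + c * t1) ^ 2 = y0 ^ 2 + y1 ^ 2 + c ^ 2 := by
      linear_combination 2 * c * hcrit - c ^ 2 * hn
    linarith
  have hc0 : c = 0 := by nlinarith
  rw [hc0] at e0 e1
  exact Plane.ext' (by linarith) (by linarith)

/-- The turning is a positive multiple of `2π`. If it exceeded `2π`, the tangent of an exposed point
would recur strictly within a period, at the same boundary point, against injectivity. -/
theorem turning_length : C.turning C.length = 2 * Real.pi := by
  have hpos := C.turning_length_pos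
  have hle : C.turning C.length ≤ 2 * Real.pi := by
    by_contra hcon
    push Not at hcon
    obtain ⟨s, hs⟩ := C.exists_exposed
    have hadd := C.turning_add_length s
    have hp := Real.pi_pos
    obtain ⟨u, hu, hu'⟩ := intermediate_value_Icc (f := C.turning)
      (by linarith [C.length_pos] : s ≤ s + C.length) C.continuous_turning.continuousOn
      (show C.turning s + 2 * Real.pi ∈ _ by constructor <;> linarith)
    have h1 : s < u := lt_of_le_of_ne hu.1 (by rintro rfl; linarith)
    have h2 : u < s + C.length := lt_of_le_of_ne hu.2 (by rintro rfl; linarith)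
    refine C.bdry_ne h1 h2 (hs u (C.tangent_eq_of_cos_eq_one ?_))
    rw [hu']; simp
  obtain ⟨j, hj⟩ := (Real.cos_eq_one_iff _).1 C.cos_turning_length
  have hp := Real.pi_pos
  have h1 : (0 : ℝ) < j := by
    by_contra hcon
    push Not at hcon
    nlinarith
  have h2 : (j : ℝ) ≤ 1 := by
    by_contra hcon
    push Not at hcon
    nlinarith
  have h3 : 0 < j := by exact_mod_cast h1
  have h4 : j ≤ 1 := by exact_mod_cast h2
  have h5 : j = 1 := by omega
  rw [← hj, h5]; simp

theorem bddAbove_curvature : BddAbove (range C.curvature) := by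
  obtain ⟨M, hM⟩ := (isCompact_Icc.image C.continuous_curvature :
    IsCompact (C.curvature '' Icc 0 C.length)).bddAbove
  refine ⟨M, ?_⟩
  rintro _ ⟨s, rfl⟩
  obtain ⟨y, hy, h⟩ := C.curvature_periodic.exists_mem_Ico₀ C.length_pos s
  rw [h]
  exact hM (mem_image_of_mem _ (Ico_subset_Icc_self hy))

theorem curvature_le (s : ℝ) : C.curvature s ≤ C.maxCurvature :=
  le_csSup C.bddAbove_curvature (mem_range_self s)

theorem maxCurvature_pos : 0 < C.maxCurvature := by
  by_contra hcon
  push Not at hcon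
  have : Antitone C.turning :=
    antitone_of_deriv_nonpos (fun s => (C.hasDerivAt_turning s).differentiableAt)
      fun s => by
        rw [(C.hasDerivAt_turning s).deriv]; exact (C.curvature_le s).trans hcon
  have h1 := this C.length_pos.le
  have h0 : C.turning 0 = 0 := by simp [turning]
  linarith [C.turning_length_pos]

/-- The inner parallel curve at a distance `r` not exceeding the radii of curvature keeps the
distance `r` from all tangent lines. -/
theorem le_height_parallel {r : ℝ} (hr : 0 ≤ r) (hrk : r * C.maxCurvature ≤ 1) (s u : ℝ) :
    r ≤ C.height s (C.bdry u + r • rotJ (C.tangent u)) := by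
  obtain ⟨u', hu', h1, h2⟩ := C.exists_mem_Icc_eq s u
  rw [← h1, ← h2]
  clear h1 h2
  set h : ℝ → ℝ := fun u => C.height s (C.bdry u + r • rotJ (C.tangent u)) with hh
  -- The factor `1 - r κ(u)` is nonnegative, so monotonicity is decided by the sine: `h` increases
  -- until the tangent has turned by `π` and decreases afterwards, with the value `r` at both ends
  -- of the period.
  have hd : ∀ u, HasDerivAt h ((1 - r * C.curvature u) *
      Real.sin (C.turning u - C.turning s)) u := fun u => by
    have h1 : HasDerivAt (fun u => C.bdry u + r • rotJ (C.tangent u) - C.bdry s)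
        (C.tangent u + r • (-C.curvature u • C.tangent u)) u :=
      ((C.hasDerivAt_bdry u).add ((C.hasDerivAt_normal u).const_smul r)).sub_const _
    have h2 := (hasDerivAt_const u (rotJ (C.tangent s))).inner ℝ h1
    rw [← C.inner_normal_tangent]
    refine h2.congr_deriv ?_
    rw [inner_zero_left, add_zero, inner_add_right, real_inner_smul_right, real_inner_smul_right]
    ring
  have hfac : ∀ u, 0 ≤ 1 - r * C.curvature u := fun u => by
    have := mul_le_mul_of_nonneg_left (C.curvature_le u) hr
    linarith
  have hs : h s = r := by
    simp only [hh]
    rw [height_add_smul, height_bdry_self, inner_normal_self]; ring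
  have hsL : h (s + C.length) = r := by
    rw [← hs]; simp only [hh, C.periodic_bdry s, C.periodic_tangent s]
  have hadd := C.turning_add_length s
  rw [C.turning_length] at hadd
  have hp := Real.pi_pos
  obtain ⟨t, ht, ht'⟩ := intermediate_value_Icc (f := C.turning)
    (by linarith [C.length_pos] : s ≤ s + C.length) C.continuous_turning.continuousOn
    (show C.turning s + Real.pi ∈ _ by constructor <;> linarith)
  rcases le_total u' t with hut | hut
  · have hm : MonotoneOn h (Icc s t) := by
      apply monotoneOn_of_deriv_nonneg (convex_Icc _ _)
        (fun u _ => (hd u).continuousAt.continuousWithinAt)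
        (fun u _ => (hd u).differentiableAt.differentiableWithinAt)
      intro u hu
      have hu := interior_subset hu
      rw [(hd u).deriv]
      have a1 := C.monotone_turning hu.1
      have a2 := C.monotone_turning hu.2
      exact mul_nonneg (hfac u) (Real.sin_nonneg_of_nonneg_of_le_pi (by linarith) (by linarith))
    have := hm (left_mem_Icc.2 ht.1) ⟨hu'.1, hut⟩ hu'.1
    rwa [hs] at this
  · have hm : AntitoneOn h (Icc t (s + C.length)) := by
      apply antitoneOn_of_deriv_nonpos (convex_Icc _ _)
        (fun u _ => (hd u).continuousAt.continuousWithinAt)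
        (fun u _ => (hd u).differentiableAt.differentiableWithinAt)
      intro u hu
      have hu := interior_subset hu
      rw [(hd u).deriv]
      have a1 := C.monotone_turning hu.1
      have a2 := C.monotone_turning hu.2
      have a3 : Real.sin (C.turning u - C.turning s) ≤ 0 := by
        rw [← Real.sin_sub_two_pi]
        exact Real.sin_nonpos_of_nonpos_of_neg_pi_le (by linarith) (by linarith)
      exact mul_nonpos_of_nonneg_of_nonpos (hfac u) a3
    have := hm ⟨hut, hu'.2⟩ (right_mem_Icc.2 ht.2) hu'.2
    rwa [hsL] at this

/-- A disk whose radius does not exceed the radii of curvature rolls freely inside the domain. -/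
theorem closedBall_subset {r : ℝ} (hr : 0 ≤ r) (hrk : r * C.maxCurvature ≤ 1) (u : ℝ) :
    Metric.closedBall (C.bdry u + r • rotJ (C.tangent u)) r ⊆ C.carrier := by
  intro y hy
  refine C.mem_of_height_nonneg fun s => ?_
  have h1 := C.le_height_parallel hr hrk s u
  set c := C.bdry u + r • rotJ (C.tangent u)
  have h2 : C.height s y = C.height s c + 1 * inner ℝ (rotJ (C.tangent s)) (y - c) := by
    rw [← height_add_smul]; simp
  have h3 := abs_real_inner_le_norm (rotJ (C.tangent s)) (y - c)
  rw [norm_rotJ, C.norm_tangent, one_mul, ← dist_eq_norm] at h3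
  have h4 := neg_le_of_abs_le h3
  have h5 := Metric.mem_closedBall.1 hy
  linarith

/-- The disk of radius `1 / κ` touching the boundary from inside at `bdry u` has its centre at least
that far from the tangent line at `bdry s`, hence from `bdry s` itself. Expanding this squared
distance gives the bound, which later limits the angle between chord and boundary. -/
theorem two_mul_height_le (s u : ℝ) :
    2 * C.height u (C.bdry s) ≤ C.maxCurvature * ‖C.bdry s - C.bdry u‖ ^ 2 := by
  have hk := C.maxCurvature_pos
  set r := (C.maxCurvature)⁻¹ with hrdef
  have hr : 0 < r := inv_pos.2 hk
  have h1 := C.le_height_parallel hr.le (inv_mul_cancel₀ hk.ne').le s u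
  have h3 := (le_abs_self _).trans
    (abs_real_inner_le_norm (rotJ (C.tangent s)) (C.bdry u + r • rotJ (C.tangent u) - C.bdry s))
  rw [norm_rotJ, C.norm_tangent, one_mul] at h3
  have h4 := h1.trans h3
  have h5 : r ^ 2 ≤ ‖C.bdry u + r • rotJ (C.tangent u) - C.bdry s‖ ^ 2 :=
    pow_le_pow_left₀ hr.le h4 2
  have h6 : C.bdry u + r • rotJ (C.tangent u) - C.bdry s
      = r • rotJ (C.tangent u) - (C.bdry s - C.bdry u) := by abel
  rw [h6, norm_sub_sq_real, norm_smul, norm_rotJ, C.norm_tangent, real_inner_smul_left,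
    Real.norm_of_nonneg hr.le] at h5
  change r ^ 2 ≤ (r * 1) ^ 2 - 2 * (r * C.height u (C.bdry s)) + _ at h5
  have h7 : C.maxCurvature * r = 1 := mul_inv_cancel₀ hk.ne'
  have h8 : 2 * (r * C.height u (C.bdry s)) ≤ ‖C.bdry s - C.bdry u‖ ^ 2 := by linarith
  calc 2 * C.height u (C.bdry s)
      = C.maxCurvature * (2 * (r * C.height u (C.bdry s))) := by
        linear_combination (-2 * C.height u (C.bdry s)) * h7
    _ ≤ _ := mul_le_mul_of_nonneg_left h8 hk.le

end Bump

/-! ### Transversal crossings of a boundary -/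

section Slope

variable {X : Type*} [NormedAddCommGroup X] [NormedSpace ℝ X]

theorem fderiv_apply_zero_one {p : X × ℝ → Plane} (hp : ContDiff ℝ 1 p) {x₀ : X} {t₀ : ℝ}
    {w : Plane} (hw : HasDerivAt (fun t => p (x₀, t)) w t₀) : fderiv ℝ p (x₀, t₀) (0, 1) = w := by
  have h1 : HasFDerivAt p (fderiv ℝ p (x₀, t₀)) (x₀, t₀) :=
    (hp.differentiable (by norm_num) _).hasFDerivAt
  have h2 : HasDerivAt (fun t : ℝ => (x₀, t)) ((0 : X), (1 : ℝ)) t₀ :=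
    (hasDerivAt_const t₀ x₀).prodMk (hasDerivAt_id t₀)
  exact (h1.comp_hasDerivAt t₀ h2).unique hw

/-- The difference quotient in time of a `C¹` map converges to its velocity, locally uniformly. -/
theorem exists_slope {p : X × ℝ → Plane} (hp : ContDiff ℝ 1 p) {x₀ : X} {t₀ : ℝ}
    {w : Plane} (hw : HasDerivAt (fun t => p (x₀, t)) w t₀) :
    ∃ u : X × ℝ × ℝ → Plane, Tendsto u (𝓝 (x₀, t₀, t₀)) (𝓝 w) ∧
      ∀ x t t', p (x, t) = p (x, t') + (t - t') • u (x, t, t') := by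
  classical
  refine ⟨fun z => if z.2.1 = z.2.2 then w else
    (z.2.1 - z.2.2)⁻¹ • (p (z.1, z.2.1) - p (z.1, z.2.2)), ?_, ?_⟩
  · have hs : HasStrictFDerivAt p (fderiv ℝ p (x₀, t₀)) (x₀, t₀) :=
      hp.contDiffAt.hasStrictFDerivAt (by norm_num)
    have hφ : Tendsto (fun z : X × ℝ × ℝ => ((z.1, z.2.1), (z.1, z.2.2))) (𝓝 (x₀, t₀, t₀))
        (𝓝 ((x₀, t₀), (x₀, t₀))) := by
      have : Continuous (fun z : X × ℝ × ℝ => ((z.1, z.2.1), (z.1, z.2.2))) := by fun_prop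
      exact this.tendsto (x₀, t₀, t₀)
    rw [Metric.tendsto_nhds]
    intro ε hε
    have h1 := hφ.eventually (hs.isLittleO.def (half_pos hε))
    filter_upwards [h1] with z hz
    split_ifs with h
    · simpa using hε
    · have hne : z.2.1 - z.2.2 ≠ 0 := sub_ne_zero.2 h
      have e1 : ((z.1, z.2.1) : X × ℝ) - (z.1, z.2.2) = (z.2.1 - z.2.2) • ((0 : X), (1 : ℝ)) := by
        ext <;> simp
      rw [e1, map_smul, fderiv_apply_zero_one hp hw, norm_smul] at hz
      have e2 : ‖((0 : X), (1 : ℝ))‖ = 1 := by simp [Prod.norm_def]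
      rw [e2, mul_one] at hz
      rw [dist_eq_norm]
      have e3 : (z.2.1 - z.2.2)⁻¹ • (p (z.1, z.2.1) - p (z.1, z.2.2)) - w =
          (z.2.1 - z.2.2)⁻¹ • (p (z.1, z.2.1) - p (z.1, z.2.2) - (z.2.1 - z.2.2) • w) := by
        rw [smul_sub _ _ ((z.2.1 - z.2.2) • w), inv_smul_smul₀ hne]
      rw [e3, norm_smul, norm_inv]
      have hpos : 0 < ‖z.2.1 - z.2.2‖ := norm_pos_iff.2 hne
      calc _ ≤ ‖z.2.1 - z.2.2‖⁻¹ * (ε / 2 * ‖z.2.1 - z.2.2‖) := by gcongr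
        _ = ε / 2 := by field_simp
        _ < ε := half_lt_self hε
  · intro x t t'
    dsimp only
    split_ifs with h
    · rw [h]; simp
    · rw [smul_inv_smul₀ (sub_ne_zero.2 h)]; abel

/-- The average velocity between two nearby times is close to `w`, hence inward pointing, so the
local statement about short inward steps applies uniformly in the initial value. -/
theorem Bump.eventually_mem_interior_of_inward (C : Bump) {p : X × ℝ → Plane}
    (hp : ContDiff ℝ 1 p) {x₀ : X} {t₀ s₀ : ℝ} {w : Plane}
    (hw : HasDerivAt (fun t => p (x₀, t)) w t₀) (h₀ : p (x₀, t₀) = C.bdry s₀)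
    (hin : 0 < inner ℝ (rotJ (C.tangent s₀)) w) :
    ∀ᶠ z : X × ℝ × ℝ in 𝓝 (x₀, t₀, t₀), z.2.2 < z.2.1 → p (z.1, z.2.2) ∈ C.carrier →
      p (z.1, z.2.1) ∈ interior C.carrier := by
  obtain ⟨u, hu, hpu⟩ := exists_slope hp hw
  have h1 : Tendsto (fun z : X × ℝ × ℝ => p (z.1, z.2.2)) (𝓝 (x₀, t₀, t₀)) (𝓝 (C.bdry s₀)) := by
    rw [← h₀]
    have : Continuous (fun z : X × ℝ × ℝ => p (z.1, z.2.2)) := hp.continuous.comp (by fun_prop)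
    exact this.tendsto (x₀, t₀, t₀)
  have h2 : Tendsto (fun z : X × ℝ × ℝ => z.2.1 - z.2.2) (𝓝 (x₀, t₀, t₀)) (𝓝 0) := by
    have : Continuous (fun z : X × ℝ × ℝ => z.2.1 - z.2.2) := by fun_prop
    simpa using this.tendsto (x₀, t₀, t₀)
  filter_upwards [(h1.prodMk_nhds (hu.prodMk_nhds h2)).eventually (C.eventually_mem_interior hin)]
    with z hz hlt hC
  rw [hpu z.1 z.2.1 z.2.2]
  exact hz hC (sub_pos.2 hlt)

/-- Time reversal of the inward case: going back from the later point is a short step in the inward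
direction `-w`. -/
theorem Bump.eventually_mem_interior_of_outward (C : Bump) {p : X × ℝ → Plane}
    (hp : ContDiff ℝ 1 p) {x₀ : X} {t₀ s₀ : ℝ} {w : Plane}
    (hw : HasDerivAt (fun t => p (x₀, t)) w t₀) (h₀ : p (x₀, t₀) = C.bdry s₀)
    (hout : inner ℝ (rotJ (C.tangent s₀)) w < 0) :
    ∀ᶠ z : X × ℝ × ℝ in 𝓝 (x₀, t₀, t₀), z.2.2 < z.2.1 → p (z.1, z.2.1) ∈ C.carrier →
      p (z.1, z.2.2) ∈ interior C.carrier := by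
  obtain ⟨u, hu, hpu⟩ := exists_slope hp hw
  have h1 : Tendsto (fun z : X × ℝ × ℝ => p (z.1, z.2.1)) (𝓝 (x₀, t₀, t₀)) (𝓝 (C.bdry s₀)) := by
    rw [← h₀]
    have : Continuous (fun z : X × ℝ × ℝ => p (z.1, z.2.1)) := hp.continuous.comp (by fun_prop)
    exact this.tendsto (x₀, t₀, t₀)
  have h2 : Tendsto (fun z : X × ℝ × ℝ => z.2.1 - z.2.2) (𝓝 (x₀, t₀, t₀)) (𝓝 0) := by
    have : Continuous (fun z : X × ℝ × ℝ => z.2.1 - z.2.2) := by fun_prop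
    simpa using this.tendsto (x₀, t₀, t₀)
  have hin : 0 < inner ℝ (rotJ (C.tangent s₀)) (-w) := by rw [inner_neg_right]; linarith
  filter_upwards [(h1.prodMk_nhds (hu.neg.prodMk_nhds h2)).eventually
    (C.eventually_mem_interior hin)] with z hz hlt hC
  have := hz hC (sub_pos.2 hlt)
  have e : p (z.1, z.2.2) = p (z.1, z.2.1) + (z.2.1 - z.2.2) • (-u z) := by
    rw [hpu z.1 z.2.1 z.2.2, smul_neg]; abel
  rwa [e]

/-- A trajectory that crosses the boundary transversally keeps doing so when the initial value is
varied, at a time and in a point that depend differentiably on the initial value. -/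
theorem Bump.exists_crossing [CompleteSpace X] (C : Bump) {p : X × ℝ → Plane}
    (hp : ContDiff ℝ 1 p) {x₀ : X} {t₀ s₀ : ℝ} {w : Plane}
    (hw : HasDerivAt (fun t => p (x₀, t)) w t₀) (h₀ : p (x₀, t₀) = C.bdry s₀)
    (hne : inner ℝ (rotJ (C.tangent s₀)) w ≠ 0) :
    ∃ T σ : X → ℝ, T x₀ = t₀ ∧ σ x₀ = s₀ ∧ DifferentiableAt ℝ T x₀ ∧ DifferentiableAt ℝ σ x₀ ∧
      ∀ᶠ x in 𝓝 x₀, p (x, T x) = C.bdry (σ x) := by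
  set f : X × ℝ × ℝ → Plane := fun z => p (z.1, z.2.1) - C.bdry z.2.2 with hf
  have hfc : ContDiff ℝ 1 f := by
    refine (hp.comp (by fun_prop : ContDiff ℝ 1 fun z : X × ℝ × ℝ => (z.1, z.2.1))).sub
      ((C.contDiff_bdry.of_le (by norm_num)).comp
        (by fun_prop : ContDiff ℝ 1 fun z : X × ℝ × ℝ => z.2.2))
  have hs : HasStrictFDerivAt f (fderiv ℝ f (x₀, t₀, s₀)) (x₀, t₀, s₀) :=
    hfc.contDiffAt.hasStrictFDerivAt (by norm_num)
  set f' := fderiv ℝ f (x₀, t₀, s₀)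
  have hfst : f' (0, 1, 0) = w := by
    have h2 : HasDerivAt (fun t : ℝ => (x₀, t, s₀)) ((0 : X), (1 : ℝ), (0 : ℝ)) t₀ :=
      (hasDerivAt_const t₀ x₀).prodMk ((hasDerivAt_id t₀).prodMk (hasDerivAt_const t₀ s₀))
    have h3 : HasDerivAt (fun t => f (x₀, t, s₀)) w t₀ := hw.sub_const (C.bdry s₀)
    have h4 := hs.hasFDerivAt.comp_hasDerivAt t₀ h2
    exact h4.unique h3
  have hsnd : f' (0, 0, 1) = -C.tangent s₀ := by
    have h2 : HasDerivAt (fun s : ℝ => (x₀, t₀, s)) ((0 : X), (0 : ℝ), (1 : ℝ)) s₀ :=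
      (hasDerivAt_const s₀ x₀).prodMk ((hasDerivAt_const s₀ t₀).prodMk (hasDerivAt_id s₀))
    have h3 : HasDerivAt (fun s => f (x₀, t₀, s)) (-C.tangent s₀) s₀ :=
      (C.hasDerivAt_bdry s₀).const_sub (p (x₀, t₀))
    have h4 := hs.hasFDerivAt.comp_hasDerivAt s₀ h2
    exact h4.unique h3
  have happ : ∀ a b : ℝ, f' (0, a, b) = a • w - b • C.tangent s₀ := fun a b => by
    have e : ((0 : X), a, b) = a • ((0 : X), (1 : ℝ), (0 : ℝ)) + b • ((0 : X), (0 : ℝ), (1 : ℝ)) := by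
      ext <;> simp
    rw [e, map_add, map_smul, map_smul, hfst, hsnd, smul_neg, sub_eq_add_neg]
  -- Transversality says that the velocity and the boundary tangent are independent, which is the
  -- hypothesis of the implicit function theorem for the time and the boundary parameter.
  have hinv : (f' ∘L .inr ℝ X (ℝ × ℝ)).IsInvertible := by
    have hinj : Function.Injective (f' ∘L .inr ℝ X (ℝ × ℝ) : ℝ × ℝ →ₗ[ℝ] Plane) := by
      rw [injective_iff_map_eq_zero]
      rintro ⟨a, b⟩ hab
      have hab : a • w - b • C.tangent s₀ = 0 := by rw [← happ]; exact hab
      have h1 : inner ℝ (rotJ (C.tangent s₀)) (a • w - b • C.tangent s₀) = (0 : ℝ) := by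
        rw [hab, inner_zero_right]
      rw [inner_sub_right, real_inner_smul_right, real_inner_smul_right, inner_rotJ_self, mul_zero,
        sub_zero] at h1
      have ha : a = 0 := (mul_eq_zero.1 h1).resolve_right hne
      rw [ha, zero_smul, zero_sub, neg_eq_zero, smul_eq_zero] at hab
      have ht : C.tangent s₀ ≠ 0 := by
        rw [← norm_ne_zero_iff, C.norm_tangent]; norm_num
      rw [ha, hab.resolve_right ht]; rfl
    refine ⟨(LinearEquiv.ofInjectiveOfFinrankEq _ hinj (by simp)).toContinuousLinearEquiv, ?_⟩
    ext <;> rfl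
  set ψ := hs.implicitFunctionOfProdDomain hinv with hψ
  have hd : DifferentiableAt ℝ ψ x₀ :=
    (hs.hasStrictFDerivAt_implicitFunctionOfProdDomain hinv).hasFDerivAt.differentiableAt
  have hval : ψ x₀ = (t₀, s₀) :=
    (hs.eventually_apply_eq_iff_implicitFunctionOfProdDomain hinv).self_of_nhds.mp rfl
  refine ⟨fun x => (ψ x).1, fun x => (ψ x).2, by simp [hval], by simp [hval], hd.fst, hd.snd, ?_⟩
  filter_upwards [hs.eventually_apply_implicitFunctionOfProdDomain hinv] with x hx
  have h2 : f (x₀, t₀, s₀) = 0 := by simp [hf, h₀]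
  rw [h2] at hx
  exact sub_eq_zero.1 hx

end Slope

/-! ### Exit time and hitting time near a given trajectory -/

namespace MagneticBumps

variable {n : ℕ} (S : MagneticBumps n)

theorem mem_Hplus_iff {l : Fin n} {x : Phase} : x ∈ S.Hplus l ↔ ‖x.2‖ = 1 ∧
    ∃ s, (S.C l).bdry s = x.1 ∧ inner ℝ (rotJ ((S.C l).tangent s)) x.2 < 0 := by
  simp only [Hplus, mem_ofPred_eq, Bump.normal_eq, inner_neg_right, real_inner_comm x.2, neg_pos]

theorem mem_Hminus_iff {l : Fin n} {x : Phase} : x ∈ S.Hminus l ↔ ‖x.2‖ = 1 ∧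
    ∃ s, (S.C l).bdry s = x.1 ∧ 0 < inner ℝ (rotJ ((S.C l).tangent s)) x.2 := by
  simp only [Hminus, mem_ofPred_eq, Bump.normal_eq, inner_neg_right, real_inner_comm x.2,
    neg_lt_zero]

theorem disjoint_Hplus_Hminus (l : Fin n) {x : Phase} (h₁ : x ∈ S.Hplus l) (h₂ : x ∈ S.Hminus l) :
    False := by
  obtain ⟨-, s, hs, h⟩ := S.mem_Hplus_iff.1 h₁
  obtain ⟨-, s', hs', h'⟩ := S.mem_Hminus_iff.1 h₂
  rw [(S.C l).tangent_eq_of_bdry_eq (hs.trans hs'.symm)] at h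
  linarith

theorem contDiff_larmorFlow_fst (b : ℝ) :
    ContDiff ℝ 1 fun z : Phase × ℝ => (larmorFlow b z.2 z.1).1 := by
  have h : ContDiff ℝ 1 fun z : Phase × ℝ => rotJ z.1.2 :=
    rotL.contDiff.comp (contDiff_snd.comp contDiff_fst)
  unfold larmorFlow
  fun_prop

theorem contDiff_larmorFlow (b : ℝ) : ContDiff ℝ 1 fun z : Phase × ℝ => larmorFlow b z.2 z.1 := by
  have h : ContDiff ℝ 1 fun z : Phase × ℝ => rotJ z.1.2 :=
    rotL.contDiff.comp (contDiff_snd.comp contDiff_fst)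
  refine (contDiff_larmorFlow_fst b).prodMk ?_
  fun_prop

theorem hasDerivAt_larmorFlow_fst {b : ℝ} (hb : b ≠ 0) (x : Phase) (t : ℝ) :
    HasDerivAt (fun t => (larmorFlow b t x).1) (larmorFlow b t x).2 t := by
  unfold larmorFlow
  have h0 : HasDerivAt (fun t => b * t) b t := by simpa using (hasDerivAt_id t).const_mul b
  have h1 := (h0.sin.smul_const x.2).fun_add ((h0.cos.const_sub 1).smul_const (rotJ x.2))
  refine ((h1.fun_const_smul b⁻¹).const_add x.1).congr_deriv ?_
  rw [smul_add, smul_smul, smul_smul]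
  congr 2 <;> field_simp

theorem larmorFlow_zero (b : ℝ) (x : Phase) : larmorFlow b 0 x = x := by
  simp [larmorFlow]

/-- A continuous path that starts in the interior and does not meet the boundary stays in the
interior. -/
theorem _root_.Bump.mem_interior_of_path (C : Bump) {c : ℝ → Plane} (hc : Continuous c) {a b : ℝ}
    (hab : a ≤ b) (ha : c a ∈ interior C.carrier) (h : ∀ t ∈ Icc a b, c t ∉ frontier C.carrier) :
    c b ∈ interior C.carrier := by
  have hp : IsPreconnected (c '' Icc a b) := isPreconnected_Icc.image _ hc.continuousOn
  have hsub : c '' Icc a b ⊆ interior C.carrier ∪ C.carrierᶜ := by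
    rintro _ ⟨t, ht, rfl⟩
    by_cases hC : c t ∈ C.carrier
    · left
      by_contra hi
      exact h t ht (by rw [C.isClosed_carrier.frontier_eq]; exact ⟨hC, hi⟩)
    · exact Or.inr hC
  by_contra hb
  have hb' : c b ∈ C.carrierᶜ :=
    (hsub (mem_image_of_mem c (right_mem_Icc.2 hab))).resolve_left hb
  obtain ⟨p, -, hp1, hp2⟩ := hp _ _ isOpen_interior C.isClosed_carrier.isOpen_compl hsub
    ⟨c a, mem_image_of_mem c (left_mem_Icc.2 hab), ha⟩
    ⟨c b, mem_image_of_mem c (right_mem_Icc.2 hab), hb'⟩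
  exact hp2 (interior_subset hp1)

theorem _root_.Bump.interior_disjoint_frontier (C : Bump) {y : Plane}
    (hy : y ∈ interior C.carrier) : y ∉ frontier C.carrier := fun h => h.2 hy

theorem eventually_larmorFlow_mem_interior {l : Fin n} {x₀ : Phase} (hx : x₀ ∈ S.Hminus l) :
    ∀ᶠ z : Phase × ℝ in 𝓝 (x₀, 0), z.1 ∈ S.Hminus l → 0 < z.2 →
      (larmorFlow (S.b l) z.2 z.1).1 ∈ interior (S.C l).carrier := by
  obtain ⟨-, s, hs, hin⟩ := S.mem_Hminus_iff.1 hx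
  have hw := hasDerivAt_larmorFlow_fst (S.b_ne_zero l) x₀ 0
  rw [larmorFlow_zero] at hw
  have h := (S.C l).eventually_mem_interior_of_inward (contDiff_larmorFlow_fst (S.b l)) hw
    (by simp only [larmorFlow_zero]; exact hs.symm) hin
  have ht : Tendsto (fun z : Phase × ℝ => (z.1, z.2, (0 : ℝ))) (𝓝 (x₀, 0)) (𝓝 (x₀, 0, 0)) := by
    have : Continuous (fun z : Phase × ℝ => (z.1, z.2, (0 : ℝ))) := by fun_prop
    exact this.tendsto (x₀, 0)
  filter_upwards [ht.eventually h] with z hz hz1 hz2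
  obtain ⟨-, s', hs', -⟩ := S.mem_Hminus_iff.1 hz1
  refine hz hz2 ?_
  simp only [larmorFlow_zero]
  rw [← hs']; exact (S.C l).bdry_mem s'

theorem exitTime_spec {l : Fin n} {x : Phase} (hx : x ∈ S.Hminus l)
    (hy : S.poincareInt l x ∈ S.Hplus l) :
    0 < S.exitTime l x ∧ (larmorFlow (S.b l) (S.exitTime l x) x).1 ∈ frontier (S.C l).carrier ∧
      ∀ t, 0 < t → t < S.exitTime l x →
        (larmorFlow (S.b l) t x).1 ∈ interior (S.C l).carrier := by
  have hcont : Continuous fun t => (larmorFlow (S.b l) t x).1 :=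
    (contDiff_larmorFlow_fst (S.b l)).continuous.comp (by fun_prop : Continuous fun t => (x, t))
  set A := {t | 0 < t ∧ (larmorFlow (S.b l) t x).1 ∈ frontier (S.C l).carrier} with hA
  have hsmall : ∀ᶠ t : ℝ in 𝓝 0, 0 < t →
      (larmorFlow (S.b l) t x).1 ∈ interior (S.C l).carrier := by
    have ht : Tendsto (fun t : ℝ => (x, t)) (𝓝 0) (𝓝 (x, 0)) := by
      have : Continuous (fun t : ℝ => (x, t)) := by fun_prop
      exact this.tendsto 0
    exact (ht.eventually (S.eventually_larmorFlow_mem_interior hx)).mono fun t h => h hx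
  obtain ⟨ε, hε, hsm⟩ := Metric.eventually_nhds_iff.1 hsmall
  have hsm' : ∀ t, 0 < t → t < ε → (larmorFlow (S.b l) t x).1 ∈ interior (S.C l).carrier :=
    fun t h0 h1 => hsm (by rwa [Real.dist_eq, sub_zero, abs_of_pos h0]) h0
  have hAε : ∀ t ∈ A, ε ≤ t := fun t ht => by
    by_contra hcon
    exact (S.C l).interior_disjoint_frontier (hsm' t ht.1 (not_le.1 hcon)) ht.2
  -- Bounding the times away from `0` removes the strict inequality, so the set is closed and its
  -- infimum is attained.
  have hAeq : A = Ici ε ∩ (fun t => (larmorFlow (S.b l) t x).1) ⁻¹' frontier (S.C l).carrier := by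
    ext t
    exact ⟨fun ht => ⟨hAε t ht, ht.2⟩, fun ht => ⟨hε.trans_le ht.1, ht.2⟩⟩
  have hAc : IsClosed A := by
    rw [hAeq]; exact isClosed_Ici.inter (isClosed_frontier.preimage hcont)
  have hAne : A.Nonempty := by
    by_contra hcon
    rw [not_nonempty_iff_eq_empty] at hcon
    -- The infimum of the empty set is `0`; then the internal map would fix `x`, which cannot point
    -- both inwards and outwards.
    have h0 : S.exitTime l x = 0 := by
      change sInf A = 0
      rw [hcon, Real.sInf_empty]
    rw [poincareInt, h0, larmorFlow_zero] at hy
    exact S.disjoint_Hplus_Hminus l hy hx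
  have hmem : S.exitTime l x ∈ A := hAc.csInf_mem hAne ⟨ε, hAε⟩
  refine ⟨hmem.1, hmem.2, fun t h0 h1 => ?_⟩
  set a := min (ε / 2) t with ha
  have ha0 : 0 < a := lt_min (half_pos hε) h0
  refine (S.C l).mem_interior_of_path hcont (min_le_right (ε / 2) t)
    (hsm' a ha0 ((min_le_left _ _).trans_lt (half_lt_self hε))) fun r hr hrf => ?_
  have : S.exitTime l x ≤ r := csInf_le ⟨ε, hAε⟩ ⟨ha0.trans_le hr.1, hrf⟩
  linarith [hr.2]

/-- The implicit function theorem only supplies some crossing time `T`. It is the first return time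
because the trajectory is in the interior before it: just after entry by the inward lemma, just
before `T` by the outward lemma, and in between by openness, uniformly by compactness in time. -/
theorem exists_exit {l : Fin n} {x₀ : Phase} (hx : x₀ ∈ S.Hminus l)
    (hy : S.poincareInt l x₀ ∈ S.Hplus l) :
    ∃ T σ : Phase → ℝ, T x₀ = S.exitTime l x₀ ∧ DifferentiableAt ℝ T x₀ ∧
      DifferentiableAt ℝ σ x₀ ∧
      (∀ᶠ x in 𝓝 x₀, (larmorFlow (S.b l) (T x) x).1 = (S.C l).bdry (σ x)) ∧
      ∀ᶠ x in 𝓝[S.Hminus l] x₀, S.exitTime l x = T x := by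
  obtain ⟨ht0, htf, hti⟩ := S.exitTime_spec hx hy
  obtain ⟨-, s, hs, hout⟩ := S.mem_Hplus_iff.1 hy
  set t₁ := S.exitTime l x₀ with ht₁
  have hw := hasDerivAt_larmorFlow_fst (S.b_ne_zero l) x₀ t₁
  have hcd := contDiff_larmorFlow_fst (S.b l)
  obtain ⟨T, σ, hT, -, hTd, hσd, hTσ⟩ := (S.C l).exists_crossing hcd hw hs.symm hout.ne
  refine ⟨T, σ, hT, hTd, hσd, hTσ, ?_⟩
  have hTc : Tendsto (fun z : Phase × ℝ => T z.1) (𝓝 (x₀, t₁)) (𝓝 t₁) := by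
    have h1 := hTd.continuousAt.tendsto
    rw [hT] at h1
    have h2 : Tendsto (fun z : Phase × ℝ => z.1) (𝓝 (x₀, t₁)) (𝓝 x₀) :=
      continuous_fst.tendsto (x₀, t₁)
    exact h1.comp h2
  have hloc : ∀ᶠ x in 𝓝 x₀, ∀ t ∈ Icc 0 (t₁ + 1), x ∈ S.Hminus l → 0 < t → t < T x →
      (larmorFlow (S.b l) t x).1 ∈ interior (S.C l).carrier := by
    apply isCompact_Icc.eventually_forall_of_forall_eventually
    intro t ht
    rcases ht.1.eq_or_lt with h0 | h0
    · subst h0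
      exact (S.eventually_larmorFlow_mem_interior hx).mono fun z h h1 h2 _ => h h1 h2
    rcases lt_trichotomy t t₁ with h1 | h1 | h1
    · have : ∀ᶠ z : Phase × ℝ in 𝓝 (x₀, t),
          (larmorFlow (S.b l) z.2 z.1).1 ∈ interior (S.C l).carrier :=
        hcd.continuous.continuousAt.eventually_mem (isOpen_interior.mem_nhds (hti t h0 h1))
      exact this.mono fun z h _ _ _ => h
    · subst h1
      have h2 := (S.C l).eventually_mem_interior_of_outward hcd hw hs.symm hout
      have h3 : Tendsto (fun z : Phase × ℝ => (z.1, T z.1, z.2)) (𝓝 (x₀, t₁))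
          (𝓝 (x₀, t₁, t₁)) :=
        (continuous_fst.tendsto (x₀, t₁)).prodMk_nhds
          (hTc.prodMk_nhds (continuous_snd.tendsto (x₀, t₁)))
      have h4 := (continuous_fst.tendsto (x₀, t₁)).eventually hTσ
      filter_upwards [h3.eventually h2, h4] with z hz hz' _ _ hlt
      refine hz hlt ?_
      rw [hz']; exact (S.C l).bdry_mem _
    · have h2 : Tendsto (fun z : Phase × ℝ => T z.1) (𝓝 (x₀, t)) (𝓝 t₁) := by
        have h1 := hTd.continuousAt.tendsto
        rw [hT] at h1
        exact h1.comp (continuous_fst.tendsto (x₀, t))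
      filter_upwards [h2.eventually_lt (continuous_snd.tendsto (x₀, t)) h1] with z hz _ _ hlt
      exact absurd hlt (not_lt.2 hz.le)
  have hpos : ∀ᶠ x in 𝓝 x₀, 0 < T x ∧ T x < t₁ + 1 := by
    have h1 := hTd.continuousAt.tendsto
    rw [hT] at h1
    exact (h1.eventually_const_lt ht0).and (h1.eventually_lt_const (lt_add_one t₁))
  filter_upwards [nhdsWithin_le_nhds hloc, nhdsWithin_le_nhds hpos, nhdsWithin_le_nhds hTσ,
    self_mem_nhdsWithin] with x h1 h2 h3 h4
  refine IsLeast.csInf_eq ⟨⟨h2.1, ?_⟩, ?_⟩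
  · rw [h3]; exact (S.C l).bdry_mem_frontier _
  · rintro t ⟨ht0, htf⟩
    by_contra hcon
    push Not at hcon
    exact (S.C l).interior_disjoint_frontier
      (h1 t ⟨ht0.le, (hcon.trans h2.2).le⟩ h4 ht0 hcon) htf

theorem contDiff_freeFlow_fst : ContDiff ℝ 1 fun z : Phase × ℝ => (freeFlow z.2 z.1).1 := by
  unfold freeFlow
  fun_prop

theorem hasDerivAt_freeFlow_fst (x : Phase) (t : ℝ) :
    HasDerivAt (fun t => (freeFlow t x).1) x.2 t := by
  unfold freeFlow
  simpa using ((hasDerivAt_id t).smul_const x.2).const_add x.1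

theorem freeFlow_zero (x : Phase) : freeFlow 0 x = x := by simp [freeFlow]

theorem freeFlow_notMem {l : Fin n} {y : Phase} (hy : y ∈ S.Hplus l) {t : ℝ} (ht : 0 < t) :
    (freeFlow t y).1 ∉ (S.C l).carrier := fun h => by
  obtain ⟨-, s, hs, hout⟩ := S.mem_Hplus_iff.1 hy
  have h1 := (S.C l).height_nonneg h s
  rw [freeFlow, Bump.height_add_smul, ← hs, Bump.height_bdry_self] at h1
  have := mul_neg_of_pos_of_neg ht hout
  linarith

theorem fst_notMem_of_mem_Hplus {l j : Fin n} (hj : j ≠ l) {y : Phase} (hy : y ∈ S.Hplus l) :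
    y.1 ∉ (S.C j).carrier := fun h => by
  obtain ⟨-, s, hs, -⟩ := S.mem_Hplus_iff.1 hy
  exact disjoint_left.1 (S.disjoint j l hj) h (hs ▸ (S.C l).bdry_mem s)

theorem isLeast_hitTimes {l : Fin n} {y : Phase} (hy : y ∈ S.Hplus l)
    (hne : (S.hitTimes y).Nonempty) : IsLeast (S.hitTimes y) (sInf (S.hitTimes y)) := by
  have hcont : Continuous fun t => (freeFlow t y).1 :=
    contDiff_freeFlow_fst.continuous.comp (by fun_prop : Continuous fun t => (y, t))
  -- The ray never returns to the convex bump `l`, and no other bump contains its starting point, so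
  -- time `0` may be admitted without changing the set. This shows that it is closed.
  have heq : S.hitTimes y = Ici 0 ∩ ⋃ j ∈ {j | j ≠ l},
      (fun t => (freeFlow t y).1) ⁻¹' (S.C j).carrier := by
    ext t
    simp only [hitTimes, mem_ofPred_eq, mem_inter_iff, mem_Ici, mem_iUnion, mem_preimage,
      exists_prop]
    constructor
    · rintro ⟨h0, j, hj⟩
      exact ⟨h0.le, j, by rintro rfl; exact S.freeFlow_notMem hy h0 hj, hj⟩
    · rintro ⟨h0, j, hjl, hj⟩
      refine ⟨h0.lt_of_ne ?_, j, hj⟩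
      rintro rfl
      rw [freeFlow_zero] at hj
      exact S.fst_notMem_of_mem_Hplus hjl hy hj
  have hcl : IsClosed (S.hitTimes y) := by
    rw [heq]
    exact isClosed_Ici.inter ((toFinite _).isClosed_biUnion fun j _ =>
      (S.C j).isClosed_carrier.preimage hcont)
  have hbdd : BddBelow (S.hitTimes y) := ⟨0, fun t ht => ht.1.le⟩
  exact ⟨hcl.csInf_mem hne hbdd, fun t ht => csInf_le hbdd ht⟩

/-- As for the exit, but all bumps must be excluded before `T`: bump `l` by convexity, bump `m` near
the hitting time by transversality, and the others because they are closed and miss the flight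
segment. -/
theorem exists_hit {l m : Fin n} {y₀ : Phase} (hy : y₀ ∈ S.Hplus l)
    (hne : (S.hitTimes y₀).Nonempty) (hz : S.poincareExt y₀ ∈ S.Hminus m) :
    ∃ T σ : Phase → ℝ, T y₀ = sInf (S.hitTimes y₀) ∧ DifferentiableAt ℝ T y₀ ∧
      DifferentiableAt ℝ σ y₀ ∧
      (∀ᶠ y in 𝓝 y₀, (freeFlow (T y) y).1 = (S.C m).bdry (σ y)) ∧
      ∀ᶠ y in 𝓝[S.Hplus l] y₀, IsLeast (S.hitTimes y) (T y) := by
  have hleast := S.isLeast_hitTimes hy hne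
  obtain ⟨-, s, hs, hin⟩ := S.mem_Hminus_iff.1 hz
  rw [poincareExt] at hs hin
  set t₁ := sInf (S.hitTimes y₀) with ht₁
  have ht0 : 0 < t₁ := hleast.1.1
  have hw := hasDerivAt_freeFlow_fst y₀ t₁
  have hcd := contDiff_freeFlow_fst
  obtain ⟨T, σ, hT, -, hTd, hσd, hTσ⟩ := (S.C m).exists_crossing hcd hw hs.symm hin.ne'
  refine ⟨T, σ, hT, hTd, hσd, hTσ, ?_⟩
  have hTc : ∀ t, Tendsto (fun z : Phase × ℝ => T z.1) (𝓝 (y₀, t)) (𝓝 t₁) := fun t => by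
    have h1 := hTd.continuousAt.tendsto
    rw [hT] at h1
    exact h1.comp (continuous_fst.tendsto (y₀, t))
  have hsmC : (freeFlow t₁ y₀).1 ∈ (S.C m).carrier := by
    rw [← hs]; exact (S.C m).bdry_mem s
  have hopen : ∀ j t, (freeFlow t y₀).1 ∉ (S.C j).carrier →
      ∀ᶠ z : Phase × ℝ in 𝓝 (y₀, t), (freeFlow z.2 z.1).1 ∉ (S.C j).carrier := fun j t h =>
    (hcd.continuous.tendsto (y₀, t)).eventually
      ((S.C j).isClosed_carrier.isOpen_compl.mem_nhds h)
  have hloc : ∀ j, ∀ᶠ y in 𝓝 y₀, ∀ t ∈ Icc 0 (t₁ + 1), y ∈ S.Hplus l → 0 < t → t < T y →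
      (freeFlow t y).1 ∉ (S.C j).carrier := by
    intro j
    by_cases hjl : j = l
    · subst hjl
      exact Eventually.of_forall fun y t _ h1 h2 _ => S.freeFlow_notMem h1 h2
    apply isCompact_Icc.eventually_forall_of_forall_eventually
    intro t ht
    rcases lt_trichotomy t t₁ with h1 | h1 | h1
    · refine (hopen j t fun hj => ?_).mono fun z h _ _ _ => h
      rcases ht.1.eq_or_lt with h0 | h0
      · rw [← h0, freeFlow_zero] at hj
        exact S.fst_notMem_of_mem_Hplus hjl hy hj
      · exact absurd (hleast.2 ⟨h0, j, hj⟩) (not_le.2 h1)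
    · subst h1
      by_cases hjm : j = m
      · subst hjm
        have h2 := (S.C j).eventually_mem_interior_of_inward hcd hw hs.symm hin
        have h3 : Tendsto (fun z : Phase × ℝ => (z.1, T z.1, z.2)) (𝓝 (y₀, t₁))
            (𝓝 (y₀, t₁, t₁)) :=
          (continuous_fst.tendsto (y₀, t₁)).prodMk_nhds
            ((hTc t₁).prodMk_nhds (continuous_snd.tendsto (y₀, t₁)))
        have h4 := (continuous_fst.tendsto (y₀, t₁)).eventually hTσ
        filter_upwards [h3.eventually h2, h4] with z hz hz' _ _ hlt hC
        have h5 := hz hlt hC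
        rw [hz'] at h5
        exact (S.C j).interior_disjoint_frontier h5 ((S.C j).bdry_mem_frontier _)
      · refine (hopen j t₁ fun hj => ?_).mono fun z h _ _ _ => h
        exact disjoint_left.1 (S.disjoint j m hjm) hj hsmC
    · filter_upwards [(hTc t).eventually_lt (continuous_snd.tendsto (y₀, t)) h1] with z hz _ _ hlt
      exact absurd hlt (not_lt.2 hz.le)
  have hpos : ∀ᶠ y in 𝓝 y₀, 0 < T y ∧ T y < t₁ + 1 := by
    have h1 := hTd.continuousAt.tendsto
    rw [hT] at h1
    exact (h1.eventually_const_lt ht0).and (h1.eventually_lt_const (lt_add_one t₁))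
  filter_upwards [nhdsWithin_le_nhds (eventually_all.2 hloc), nhdsWithin_le_nhds hpos,
    nhdsWithin_le_nhds hTσ, self_mem_nhdsWithin] with y h1 h2 h3 h4
  refine ⟨⟨h2.1, m, ?_⟩, ?_⟩
  · rw [h3]; exact (S.C m).bdry_mem _
  · rintro t ⟨ht0, j, hj⟩
    by_contra hcon
    push Not at hcon
    exact h1 j t ⟨ht0.le, (hcon.trans h2.2).le⟩ h4 ht0 hcon hj

end MagneticBumps

/-! ### Distances, the minimal angle and the strong field inequality -/

namespace MagneticBumps

variable {n : ℕ} (S : MagneticBumps n)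

theorem d_le_dist {l m : Fin n} (hm : m ≠ l) {x y : Plane} (hx : x ∈ (S.C l).carrier)
    (hy : y ∈ (S.C m).carrier) : S.d l ≤ dist x y :=
  csInf_le ⟨0, by rintro _ ⟨m, -, x, -, y, -, rfl⟩; exact dist_nonneg⟩ ⟨m, hm, x, hx, y, hy, rfl⟩

theorem carrier_nonempty (C : Bump) : C.carrier.Nonempty := C.interior_nonempty.mono interior_subset

theorem d_pos (hn : 2 ≤ n) (l : Fin n) : 0 < S.d l := by
  have hcl : IsClosed (⋃ m ∈ {m | m ≠ l}, (S.C m).carrier) :=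
    (toFinite _).isClosed_biUnion fun m _ => (S.C m).isClosed_carrier
  have hdis : Disjoint (S.C l).carrier (⋃ m ∈ {m | m ≠ l}, (S.C m).carrier) := by
    rw [disjoint_iUnion₂_right]
    exact fun m hm => (S.disjoint m l hm).symm
  obtain ⟨r, hr, h⟩ := Metric.exists_pos_forall_lt_edist (S.C l).isCompact hcl hdis
  have : Nontrivial (Fin n) := Fin.nontrivial_iff_two_le.2 hn
  obtain ⟨m, hm⟩ := exists_ne l
  obtain ⟨x, hx⟩ := carrier_nonempty (S.C l)
  obtain ⟨y, hy⟩ := carrier_nonempty (S.C m)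
  refine lt_of_lt_of_le (NNReal.coe_pos.2 hr) (le_csInf ⟨_, m, hm, x, hx, y, hy, rfl⟩ ?_)
  rintro _ ⟨m, hm, x, hx, y, hy, rfl⟩
  have := h x hx y (mem_biUnion (show m ∈ {m | m ≠ l} from hm) hy)
  rw [edist_nndist] at this
  have h2 : r < nndist x y := by exact_mod_cast this
  rw [← coe_nndist]
  exact_mod_cast h2.le

theorem exists_three (hn : 2 ≤ n) (h2 : n ≠ 2) : ∃ k l m : Fin n, k ≠ l ∧ l ≠ m ∧ m ≠ k :=
  ⟨⟨0, by omega⟩, ⟨1, by omega⟩, ⟨2, by omega⟩, by simp, by simp, by simp⟩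

/-- All three angles of a triangle with vertices in three bumps are at least the infimum, and they
add up to `π`. -/
theorem alphaMin_le (hn : 2 ≤ n) : S.alphaMin ≤ Real.pi / 3 := by
  unfold alphaMin
  split_ifs with h2
  · exact le_rfl
  obtain ⟨k, l, m, hkl, hlm, hmk⟩ := exists_three hn h2
  obtain ⟨x, hx⟩ := carrier_nonempty (S.C k)
  obtain ⟨y, hy⟩ := carrier_nonempty (S.C l)
  obtain ⟨z, hz⟩ := carrier_nonempty (S.C m)
  have hxy : y ≠ x := by
    rintro rfl; exact disjoint_left.1 (S.disjoint k l hkl) hx hy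
  have hsum := EuclideanGeometry.angle_add_angle_add_angle_eq_pi z hxy
  set A := {α | ∃ k l m, k ≠ l ∧ l ≠ m ∧ m ≠ k ∧
      ∃ x ∈ (S.C k).carrier, ∃ y ∈ (S.C l).carrier, ∃ z ∈ (S.C m).carrier,
        α = EuclideanGeometry.angle x y z}
  have hb : BddBelow A := ⟨0, by
    rintro _ ⟨k, l, m, -, -, -, x, -, y, -, z, -, rfl⟩
    exact EuclideanGeometry.angle_nonneg x y z⟩
  have h1 : sInf A ≤ EuclideanGeometry.angle x y z :=
    csInf_le hb ⟨k, l, m, hkl, hlm, hmk, x, hx, y, hy, z, hz, rfl⟩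
  have h3 : sInf A ≤ EuclideanGeometry.angle y z x :=
    csInf_le hb ⟨l, m, k, hlm, hmk, hkl, y, hy, z, hz, x, hx, rfl⟩
  have h4 : sInf A ≤ EuclideanGeometry.angle z x y :=
    csInf_le hb ⟨m, k, l, hmk, hkl, hlm, z, hz, x, hx, y, hy, rfl⟩
  linarith

/-- The angles form a compact set, since the angle is continuous at triples of distinct points; so
the infimum is attained, and a zero angle would put three bumps on a line. -/
theorem alphaMin_pos (hn : 2 ≤ n) (hline : S.NoThreeOnLine) : 0 < S.alphaMin := by
  unfold alphaMin
  split_ifs with h2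
  · have := Real.pi_pos; positivity
  set A := {α | ∃ k l m, k ≠ l ∧ l ≠ m ∧ m ≠ k ∧
      ∃ x ∈ (S.C k).carrier, ∃ y ∈ (S.C l).carrier, ∃ z ∈ (S.C m).carrier,
        α = EuclideanGeometry.angle x y z} with hA
  set I : Set (Fin n × Fin n × Fin n) := {i | i.1 ≠ i.2.1 ∧ i.2.1 ≠ i.2.2 ∧ i.2.2 ≠ i.1}
  have hAeq : A = ⋃ i ∈ I, (fun y : Plane × Plane × Plane =>
      EuclideanGeometry.angle y.1 y.2.1 y.2.2) ''
        ((S.C i.1).carrier ×ˢ (S.C i.2.1).carrier ×ˢ (S.C i.2.2).carrier) := by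
    ext α
    simp only [mem_iUnion, mem_image, mem_prod, exists_prop, Prod.exists]
    constructor
    · rintro ⟨k, l, m, h1, h2, h3, x, hx, y, hy, z, hz, rfl⟩
      exact ⟨k, l, m, ⟨h1, h2, h3⟩, x, y, z, ⟨hx, hy, hz⟩, rfl⟩
    · rintro ⟨k, l, m, ⟨h1, h2, h3⟩, x, y, z, ⟨hx, hy, hz⟩, rfl⟩
      exact ⟨k, l, m, h1, h2, h3, x, hx, y, hy, z, hz, rfl⟩
  have hcomp : IsCompact A := by
    rw [hAeq]
    refine (toFinite I).isCompact_biUnion fun i hi => ?_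
    refine ((S.C i.1).isCompact.prod ((S.C i.2.1).isCompact.prod
      (S.C i.2.2).isCompact)).image_of_continuousOn fun y hy => ?_
    refine (EuclideanGeometry.continuousAt_angle (fun h => ?_) (fun h => ?_)).continuousWithinAt
    · exact disjoint_left.1 (S.disjoint _ _ hi.1) hy.1 (h ▸ hy.2.1)
    · exact disjoint_left.1 (S.disjoint _ _ hi.2.1) hy.2.1 (h ▸ hy.2.2)
  have hne : A.Nonempty := by
    obtain ⟨k, l, m, hkl, hlm, hmk⟩ := exists_three hn h2
    obtain ⟨x, hx⟩ := carrier_nonempty (S.C k)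
    obtain ⟨y, hy⟩ := carrier_nonempty (S.C l)
    obtain ⟨z, hz⟩ := carrier_nonempty (S.C m)
    exact ⟨_, k, l, m, hkl, hlm, hmk, x, hx, y, hy, z, hz, rfl⟩
  obtain ⟨k, l, m, hkl, hlm, hmk, x, hx, y, hy, z, hz, h⟩ := hcomp.sInf_mem hne
  rw [h]
  refine (EuclideanGeometry.angle_nonneg x y z).lt_of_ne' fun h0 => ?_
  exact hline k l m hkl hlm hmk x hx y hy z hz (EuclideanGeometry.collinear_of_angle_eq_zero h0)

/-- This is the only form in which the strong field inequality enters the quantitative estimates: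
the angle is replaced by its upper bound `π / 3`. -/
theorem VeryStrong.three_lt {S : MagneticBumps n} (hstrong : S.VeryStrong) (hn : 2 ≤ n)
    (hline : S.NoThreeOnLine) (l : Fin n) :
    3 < Real.pi * (S.d l * (|S.b l| - 2 * (S.C l).maxCurvature)) := by
  have h := hstrong l
  have hd := S.d_pos hn l
  have hα := S.alphaMin_pos hn hline
  have hα' := S.alphaMin_le hn
  have hp := Real.pi_pos
  have h1 : 1 / (S.d l * S.alphaMin) < |S.b l| - 2 * (S.C l).maxCurvature := by linarith
  rw [div_lt_iff₀ (mul_pos hd hα)] at h1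
  have h2 : 0 < |S.b l| - 2 * (S.C l).maxCurvature := by
    by_contra hcon
    push Not at hcon
    have := mul_nonpos_of_nonpos_of_nonneg hcon (mul_pos hd hα).le
    linarith
  have h3 := mul_le_mul_of_nonneg_left hα' (mul_pos h2 hd).le
  nlinarith

end MagneticBumps

/-! ### The trigonometric inequality behind the cone condition -/

section Estimates

variable {S C S₁ C₁ S₂ C₂ k : ℝ}

/-- If `S = sin a`, `C = cos a`, `S₁ = sin ω`, `C₁ = cos ω` with `sin ω < sin a` and
`0 < sin (a + ω)` then `ω` is acute and less than `a`. -/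
theorem acute_of_sin_lt (hSC : S ^ 2 + C ^ 2 = 1) (hSC₁ : S₁ ^ 2 + C₁ ^ 2 = 1) (h₀ : 0 ≤ S₁)
    (hlt : S₁ < S) (hp : 0 < S * C₁ + C * S₁) : 0 < C₁ ∧ C < C₁ ∧ 0 < S * C₁ - C * S₁ := by
  have hS : 0 < S := h₀.trans_lt hlt
  have hsq : S₁ ^ 2 < S ^ 2 := pow_lt_pow_left₀ hlt h₀ (by norm_num)
  -- This is `sin (a + ω) sin (a - ω) = sin² a - sin² ω`.
  have hprod : 0 < (S * C₁ + C * S₁) * (S * C₁ - C * S₁) := by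
    have : (S * C₁ + C * S₁) * (S * C₁ - C * S₁) = S ^ 2 - S₁ ^ 2 := by
      linear_combination S ^ 2 * hSC₁ - S₁ ^ 2 * hSC
    rw [this]; linarith
  have hm : 0 < S * C₁ - C * S₁ := (pos_iff_pos_of_mul_pos hprod).1 hp
  have hC₁ : 0 < C₁ := by
    have : 0 < S * C₁ := by linarith
    exact (pos_iff_pos_of_mul_pos this).1 hS
  refine ⟨hC₁, ?_, hm⟩
  by_contra hcon
  push Not at hcon
  have := pow_le_pow_left₀ hC₁.le hcon 2
  linarith

/-- Lengths are measured in Larmor radii. `S, C` belong to half the turning angle `a`, `Sᵢ, Cᵢ` to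
the angles `ωᵢ` between chord and boundary, `k` is `κ / |b|`, `t` the flight length, `δ` and `δm`
the distances `d` of the two bumps. The expression is, up to sign and a positive factor, the lower
coefficient of the image of the upper edge. The second summand is nonnegative, and the first is
negative only if `a` is near `π / 4` and `k` is small; `hball` then makes the second large enough.
-/
theorem cone_estimate {δ Δ δm t : ℝ} (hSC : S ^ 2 + C ^ 2 = 1) (hSC₁ : S₁ ^ 2 + C₁ ^ 2 = 1)
    (hSC₂ : S₂ ^ 2 + C₂ ^ 2 = 1) (hS : 0 < S) (hS₁ : 0 ≤ S₁) (hS₂ : 0 ≤ S₂) (hk : k < 1 / 2)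
    (hS₁k : S₁ ≤ k * S) (hS₂k : S₂ ≤ k * S) (hp₁ : 0 < S * C₁ + C * S₁)
    (hp₂ : 0 < S * C₂ + C * S₂) (hδ : 954 / 1000 < δ * (1 - 2 * k)) (hδΔ : δ ≤ Δ) (hδm : δm ≤ Δ)
    (hΔt : Δ ≤ t) (hball : (Δ + 2) ^ 2 ≤ 4 + 4 * t * (S * C₂ + C * S₂) + t ^ 2) :
    0 < (S * C₂ + C * S₂) * (δ * (S * C₁ - C * S₁) - 2 * S * C * (S * C₁ + C * S₁)) +
      (t - δm) * (δ * (S₁ * C₂ + C₁ * S₂) + (S * C₁ + C * S₁) * (S * C₂ - C * S₂)) := by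
  have hk0 : 0 ≤ k := by
    by_contra hcon
    push Not at hcon
    have := mul_neg_of_neg_of_pos hcon hS
    linarith
  have hkS : k * S < S := by nlinarith
  obtain ⟨hC₁, hCC₁, hm₁⟩ := acute_of_sin_lt hSC hSC₁ hS₁ (hS₁k.trans_lt hkS) hp₁
  obtain ⟨hC₂, hCC₂, hm₂⟩ := acute_of_sin_lt hSC hSC₂ hS₂ (hS₂k.trans_lt hkS) hp₂
  have hδ1 : 954 / 1000 < δ := by
    by_contra hcon
    push Not at hcon
    nlinarith
  have hE : 0 ≤ S₁ * C₂ + C₁ * S₂ := by positivity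
  set P₁ := S * C₁ + C * S₁ with hP₁
  set M₁ := S * C₁ - C * S₁ with hM₁
  set P₂ := S * C₂ + C * S₂ with hP₂
  set M₂ := S * C₂ - C * S₂ with hM₂
  set E := S₁ * C₂ + C₁ * S₂ with hEdef
  have hQ : 0 < δ * E + P₁ * M₂ := by
    have h1 := mul_pos hp₁ hm₂
    have h2 : 0 ≤ δ * E := mul_nonneg (by linarith) hE
    linarith
  by_cases hcase : 2 * S * C * P₁ < δ * M₁
  · have h1 := mul_pos hp₂ (sub_pos.2 hcase)
    have h2 := mul_nonneg (by linarith : 0 ≤ t - δm) hQ.le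
    linarith
  push Not at hcase
  have hδM : 0 < δ * M₁ := mul_pos (by linarith) hm₁
  have hC : 0 < C := by
    by_contra hcon
    push Not at hcon
    have h1 : S * C * P₁ ≤ 0 :=
      mul_nonpos_of_nonpos_of_nonneg (mul_nonpos_of_nonneg_of_nonpos hS.le hcon) hp₁.le
    linarith
  have h2SC : 2 * S * C ≤ 1 := by linarith [sq_nonneg (S - C)]
  have h2SC0 : 0 < 2 * S * C := by positivity
  have hx : C * S₁ ≤ k * (S * C₁) := by
    calc C * S₁ ≤ C * (k * S) := by gcongr
      _ ≤ C₁ * (k * S) := by gcongr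
      _ = _ := by ring
  have hPM : (1 - k) * P₁ ≤ (1 + k) * M₁ := by
    rw [hP₁, hM₁]; linarith
  have he1 : δ * (1 - k) ≤ 2 * S * C * (1 + k) := by
    have h1 : M₁ * (δ * (1 - k)) ≤ M₁ * (2 * S * C * (1 + k)) := by
      have a1 := mul_le_mul_of_nonneg_right hcase (by linarith : 0 ≤ 1 - k)
      have a2 := mul_le_mul_of_nonneg_left hPM h2SC0.le
      linarith
    exact le_of_mul_le_mul_left h1 hm₁
  have h12k : 0 < 1 - 2 * k := by linarith
  have h1k : 0 < 1 - k := by linarith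
  have he2 : 954 / 1000 * (1 - k) < 2 * S * C * ((1 + k) * (1 - 2 * k)) := by
    have a1 := mul_lt_mul_of_pos_right hδ h1k
    have a2 := mul_le_mul_of_nonneg_right he1 h12k.le
    linarith
  have hle : 2 * S * C * ((1 + k) * (1 - 2 * k)) ≤ (1 + k) * (1 - 2 * k) := by
    have h1 : 0 ≤ (1 + k) * (1 - 2 * k) := mul_nonneg (by linarith) h12k.le
    exact mul_le_of_le_one_left h1 h2SC
  have hk15 : k < 15 / 100 := by
    by_contra hcon
    push Not at hcon
    have h1 := mul_le_mul_of_nonneg_right hcon hk0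
    have h2 := he2.trans_le hle
    linarith
  -- So `sin 2a` is close to `1`, which keeps `a` near `π / 4`.
  have h2SC' : 954 / 1000 < 2 * S * C := by
    have : (1 + k) * (1 - 2 * k) ≤ 1 - k := by linarith [sq_nonneg k]
    have a := mul_le_mul_of_nonneg_left this h2SC0.le
    have b := he2.trans_le a
    exact lt_of_mul_lt_mul_right b h1k.le
  have hdef : 2 * S * C * P₁ - δ * M₁ ≤ 5 / 100 * M₁ := by
    have hpos : 0 < (1 - k) * (1 - 2 * k) := mul_pos h1k h12k
    have a1 := mul_le_mul_of_nonneg_left hPM (mul_pos h2SC0 h12k).le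
    have a2 := mul_le_mul_of_nonneg_left hδ.le (mul_pos h1k hm₁).le
    have a3 := mul_le_mul_of_nonneg_left hle hm₁.le
    have a4 : (1 + k) * (1 - 2 * k) - 954 / 1000 * (1 - k) ≤ 5 / 100 * ((1 - k) * (1 - 2 * k)) := by
      -- `52 / 2100` is the vertex of the quadratic in `k` given by the difference of the two sides.
      linarith [sq_nonneg (k - 52 / 2100)]
    have a5 := mul_le_mul_of_nonneg_left a4 hm₁.le
    refine le_of_mul_le_mul_left ?_ hpos
    linarith
  -- The exit is oblique: `S < 0.807` because `4 · 0.65 · 0.35 < 0.954²`, and `C S₂` adds at most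
  -- `0.15 · S C ≤ 0.075`.
  have hP₂le : P₂ ≤ 882 / 1000 := by
    have hS2 : S ^ 2 < 65 / 100 := by
      by_contra hcon
      push Not at hcon
      have h1 : (2 * S * C) ^ 2 = 4 * S ^ 2 * (1 - S ^ 2) := by
        linear_combination 4 * S ^ 2 * hSC
      have h2 : (954 / 1000) ^ 2 < (2 * S * C) ^ 2 := pow_lt_pow_left₀ h2SC' (by norm_num) (by norm_num)
      have h3 := mul_nonneg (sub_nonneg.2 hcon) (by linarith : 0 ≤ S ^ 2 - 35 / 100)
      linarith
    have hS' : S < 807 / 1000 := by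
      by_contra hcon
      push Not at hcon
      have h1 := pow_le_pow_left₀ (by norm_num) hcon 2
      linarith
    have hC₂1 : C₂ ≤ 1 := by
      by_contra hcon
      push Not at hcon
      have h1 := pow_lt_pow_left₀ hcon zero_le_one two_ne_zero
      linarith [sq_nonneg S₂]
    have h1 : S * C₂ ≤ S := mul_le_of_le_one_right hS.le hC₂1
    have h2 : C * S₂ ≤ 15 / 100 * (S * C) := by
      calc C * S₂ ≤ C * (k * S) := by gcongr
        _ ≤ C * (15 / 100 * S) := by gcongr
        _ = _ := by ring
    rw [hP₂]
    linarith
  -- The surplus is chosen as `0.05 · 1.05`, the product of the constants in `hdef` and `hswap`.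
  have hflight : 525 / 10000 < t - Δ := by
    by_contra hcon
    push Not at hcon
    have hΔ0 : 954 / 1000 < Δ := by linarith
    have ht0 : 0 ≤ t := by linarith
    have a1 : t * P₂ ≤ t * (882 / 1000) := mul_le_mul_of_nonneg_left hP₂le ht0
    have a2 : t ≤ Δ + 525 / 10000 := by linarith
    have a3 : t ^ 2 ≤ (Δ + 525 / 10000) ^ 2 := pow_le_pow_left₀ ht0 a2 2
    linarith
  have hswap : P₂ * M₁ ≤ 105 / 100 * (δ * E + P₁ * M₂) := by
    have h1 : P₂ * M₁ = P₁ * M₂ + 2 * S * C * (S₂ * C₁ - C₂ * S₁) := by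
      rw [hP₁, hP₂, hM₁, hM₂]; ring
    have h2 : 2 * S * C * (S₂ * C₁ - C₂ * S₁) ≤ E := by
      have b1 : S₂ * C₁ - C₂ * S₁ ≤ E := by
        rw [hEdef]; linarith [mul_nonneg hC₂.le hS₁]
      have b2 := mul_le_mul_of_nonneg_left b1 h2SC0.le
      have b3 := mul_le_mul_of_nonneg_right h2SC hE
      linarith
    have h3 := mul_le_mul_of_nonneg_right hδ1.le hE
    have h4 := mul_pos hp₁ hm₂
    linarith
  have f1 := mul_le_mul_of_nonneg_left hdef hp₂.le
  have f2 : 525 / 10000 * (δ * E + P₁ * M₂) < (t - δm) * (δ * E + P₁ * M₂) :=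
    mul_lt_mul_of_pos_right (by linarith) hQ
  linarith

end Estimates

/-! ### The derivative of the Poincaré map -/

namespace MagneticBumps

variable {n : ℕ} (S : MagneticBumps n)

theorem norm_larmorFlow_snd (b t : ℝ) (x : Phase) : ‖(larmorFlow b t x).2‖ = ‖x.2‖ := by
  have : ‖(larmorFlow b t x).2‖ ^ 2 = ‖x.2‖ ^ 2 := by
    rw [Plane.norm_sq_eq, Plane.norm_sq_eq]
    simp only [larmorFlow, PiLp.add_apply, PiLp.smul_apply, smul_eq_mul, rotJ_apply_zero,
      rotJ_apply_one]
    linear_combination (x.2 0 ^ 2 + x.2 1 ^ 2) * Real.sin_sq_add_cos_sq (b * t)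
  exact (sq_eq_sq₀ (norm_nonneg _) (norm_nonneg _)).1 this

/-- After a full Larmor circle the trajectory is back at its boundary point `x`, pointing inwards.
This can be neither the exit itself nor an interior point of the path before it. -/
theorem abs_mul_exitTime_lt {l : Fin n} {x : Phase} (hx : x ∈ S.Hminus l)
    (hy : S.poincareInt l x ∈ S.Hplus l) : |S.b l| * S.exitTime l x < 2 * Real.pi := by
  obtain ⟨-, -, hti⟩ := S.exitTime_spec hx hy
  have hb := abs_pos.2 (S.b_ne_zero l)
  have hper : larmorFlow (S.b l) (2 * Real.pi / |S.b l|) x = x := by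
    have h : Real.cos (S.b l * (2 * Real.pi / |S.b l|)) = 1 ∧
        Real.sin (S.b l * (2 * Real.pi / |S.b l|)) = 0 := by
      rcases (S.b_ne_zero l).lt_or_gt with h | h
      · rw [abs_of_neg h, show S.b l * (2 * Real.pi / -S.b l) = -(2 * Real.pi) by
          rw [div_neg, mul_neg, mul_div_cancel₀ _ h.ne]]
        simp
      · rw [abs_of_pos h, show S.b l * (2 * Real.pi / S.b l) = 2 * Real.pi by field_simp]
        simp
    simp [larmorFlow, h.1, h.2]
  by_contra hcon
  push Not at hcon
  have h1 : 2 * Real.pi / |S.b l| ≤ S.exitTime l x := by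
    rw [div_le_iff₀ hb]; linarith
  rcases h1.eq_or_lt with h2 | h2
  · rw [poincareInt, ← h2, hper] at hy
    exact S.disjoint_Hplus_Hminus l hy hx
  · have h3 := hti _ (div_pos Real.two_pi_pos hb) h2
    rw [hper] at h3
    obtain ⟨-, s, hs, -⟩ := S.mem_Hminus_iff.1 hx
    exact (S.C l).interior_disjoint_frontier h3 (hs ▸ (S.C l).bdry_mem_frontier s)

/-- The chord from the point of entry to the point of exit: `S` and `C` are the sine and cosine of
half the angle by which the velocity turns inside the bump, `e` is the sign of the field. -/
theorem exists_chord {l : Fin n} {x : Phase} (hx : x ∈ S.Hminus l)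
    (hy : S.poincareInt l x ∈ S.Hplus l) :
    ∃ e A B : ℝ, e ^ 2 = 1 ∧ e * |S.b l| = S.b l ∧ A ^ 2 + B ^ 2 = 1 ∧ 0 < A ∧
      Real.sin (S.b l * S.exitTime l x) = 2 * e * A * B ∧
      Real.cos (S.b l * S.exitTime l x) = B ^ 2 - A ^ 2 ∧
      (S.poincareInt l x).1 - x.1 = (2 * A / |S.b l|) • (B • x.2 + (e * A) • rotJ x.2) := by
  have hlt := S.abs_mul_exitTime_lt hx hy
  have ht0 := (S.exitTime_spec hx hy).1
  have hb := abs_pos.2 (S.b_ne_zero l)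
  have hp := mul_pos hb ht0
  set a := |S.b l| * S.exitTime l x / 2 with ha
  obtain ⟨e, he2, heb⟩ : ∃ e : ℝ, (e = 1 ∨ e = -1) ∧ e * |S.b l| = S.b l := by
    rcases (S.b_ne_zero l).lt_or_gt with h | h
    · exact ⟨-1, Or.inr rfl, by rw [abs_of_neg h]; ring⟩
    · exact ⟨1, Or.inl rfl, by rw [abs_of_pos h]; ring⟩
  have hesq : e ^ 2 = 1 := by rcases he2 with rfl | rfl <;> norm_num
  have hφ : S.b l * S.exitTime l x = e * (2 * a) := by
    rw [ha, ← heb]; simp only [abs_mul, abs_abs]; rcases he2 with rfl | rfl <;> simp <;> ring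
  have hsin : Real.sin (S.b l * S.exitTime l x) = 2 * e * Real.sin a * Real.cos a := by
    rw [hφ]
    rcases he2 with rfl | rfl
    · rw [one_mul, Real.sin_two_mul]; ring
    · rw [neg_one_mul, Real.sin_neg, Real.sin_two_mul]; ring
  have hcos : Real.cos (S.b l * S.exitTime l x) = Real.cos a ^ 2 - Real.sin a ^ 2 := by
    rw [hφ]
    rcases he2 with rfl | rfl
    · rw [one_mul, Real.cos_two_mul']
    · rw [neg_one_mul, Real.cos_neg, Real.cos_two_mul']
  refine ⟨e, Real.sin a, Real.cos a, hesq, heb, Real.sin_sq_add_cos_sq a,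
    Real.sin_pos_of_pos_of_lt_pi (by positivity) (by linarith), hsin, hcos, ?_⟩
  have hinv : (S.b l)⁻¹ = e / |S.b l| := by
    have h1 : S.b l * (e / |S.b l|) = 1 := by
      calc S.b l * (e / |S.b l|) = e * |S.b l| * (e / |S.b l|) := by rw [heb]
        _ = 1 := by field_simp; exact hesq
    exact inv_eq_of_mul_eq_one_right h1
  have h1c : 1 - (Real.cos a ^ 2 - Real.sin a ^ 2) = 2 * Real.sin a ^ 2 := by
    linear_combination -Real.sin_sq_add_cos_sq a
  simp only [poincareInt, larmorFlow, hsin, hcos, hinv, h1c, add_sub_cancel_left]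
  rw [smul_add, smul_add, smul_smul, smul_smul, smul_smul, smul_smul]
  congr 2
  · linear_combination (2 * Real.sin a * Real.cos a / |S.b l|) * hesq
  · ring

/-- The linearization of the Poincaré map. -/
theorem poincare_deriv {l m : Fin n} {x : Phase} (hx : x ∈ S.Uminus l)
    (hm : S.poincare l x ∈ S.Hminus m) :
    DifferentiableWithinAt ℝ (S.poincare l) (S.Uminus l) x ∧
      ∀ D : Phase →L[ℝ] Phase, HasFDerivWithinAt (S.poincare l) D (S.Uminus l) x →
      ∀ s s₂ s₃ a c : ℝ, (S.C l).bdry s = x.1 → (S.C l).bdry s₂ = (S.poincareInt l x).1 →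
        (S.C m).bdry s₃ = (S.poincare l x).1 →
        ∃ t' σ' τ' σ₃' : ℝ,
          a • (S.C l).tangent s + t' • (S.poincareInt l x).2 +
            ((S.b l)⁻¹ * c) • (Real.sin (S.b l * S.exitTime l x) • rotJ x.2 -
              (1 - Real.cos (S.b l * S.exitTime l x)) • x.2) = σ' • (S.C l).tangent s₂ ∧
          σ' • (S.C l).tangent s₂ + τ' • (S.poincareInt l x).2 +
            (sInf (S.hitTimes (S.poincareInt l x)) * (c + S.b l * t')) •
              rotJ (S.poincareInt l x).2 = σ₃' • (S.C m).tangent s₃ ∧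
          D (a • (S.C l).tangent s, c • rotJ x.2) =
            (σ₃' • (S.C m).tangent s₃, (c + S.b l * t') • rotJ (S.poincareInt l x).2) := by
  obtain ⟨hxm, hy, hne, -⟩ := hx
  have hb := S.b_ne_zero l
  obtain ⟨T, σ, hT, hTd, hσd, hTσ, hTe⟩ := S.exists_exit hxm hy
  set G : Phase → Phase := fun x => larmorFlow (S.b l) (T x) x with hG
  have hGx : G x = S.poincareInt l x := by simp only [hG, hT]; rfl
  obtain ⟨T₂, σ₂, hT₂, hT₂d, hσ₂d, hT₂σ, hT₂e⟩ := S.exists_hit (m := m) hy hne hm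
  rw [← hGx] at hT₂ hT₂d hσ₂d hT₂σ hT₂e
  have hGd : DifferentiableAt ℝ G x := by
    have h1 : DifferentiableAt ℝ (fun z : Phase × ℝ => larmorFlow (S.b l) z.2 z.1) (x, T x) :=
      (contDiff_larmorFlow (S.b l)).differentiable (by norm_num) _
    exact h1.comp x (differentiableAt_id.prodMk hTd)
  have hGe : ∀ᶠ x' in 𝓝[S.Hminus l] x, S.poincareInt l x' = G x' :=
    hTe.mono fun x' h => by simp only [poincareInt, h, hG]
  have hσx : (S.C l).bdry (σ x) = (G x).1 := hTσ.self_of_nhds.symm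
  have hσ₂x : (S.C m).bdry (σ₂ (G x)) = (freeFlow (T₂ (G x)) (G x)).1 := hT₂σ.self_of_nhds.symm
  have hP : S.poincare l x = freeFlow (T₂ (G x)) (G x) := by
    rw [hT₂, hGx]; rfl
  have hGplus : ∀ᶠ x' in 𝓝[S.Hminus l] x, G x' ∈ S.Hplus l := by
    have h1 : ∀ᶠ x' in 𝓝 x, inner ℝ (rotJ ((S.C l).tangent (σ x'))) (G x').2 < 0 := by
      have hc : ContinuousAt (fun x' => (inner ℝ (rotJ ((S.C l).tangent (σ x'))) (G x').2 : ℝ)) x :=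
        ((S.C l).continuous_normal.continuousAt.comp hσd.continuousAt).inner
          hGd.continuousAt.snd
      refine hc.tendsto.eventually_lt_const ?_
      obtain ⟨-, s, hs, hout⟩ := S.mem_Hplus_iff.1 hy
      rw [hGx] at hσx ⊢
      rwa [(S.C l).tangent_eq_of_bdry_eq (hσx.trans hs.symm)]
    filter_upwards [nhdsWithin_le_nhds h1, nhdsWithin_le_nhds hTσ, self_mem_nhdsWithin]
      with x' h2 h3 h4
    exact S.mem_Hplus_iff.2 ⟨by rw [norm_larmorFlow_snd]; exact h4.1, σ x', h3.symm, h2⟩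
  have hGt : Tendsto G (𝓝[S.Hminus l] x) (𝓝[S.Hplus l] (G x)) :=
    tendsto_nhdsWithin_iff.2 ⟨hGd.continuousAt.tendsto.mono_left nhdsWithin_le_nhds, hGplus⟩
  have hQm : ∀ᶠ y in 𝓝[S.Hplus l] (G x), freeFlow (T₂ y) y ∈ S.Hminus m := by
    have h1 : ∀ᶠ y in 𝓝 (G x), 0 < inner ℝ (rotJ ((S.C m).tangent (σ₂ y))) y.2 := by
      have hc : ContinuousAt (fun y : Phase =>
          (inner ℝ (rotJ ((S.C m).tangent (σ₂ y))) y.2 : ℝ)) (G x) :=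
        ((S.C m).continuous_normal.continuousAt.comp hσ₂d.continuousAt).inner
          continuousAt_snd
      refine hc.tendsto.eventually_const_lt ?_
      obtain ⟨-, s, hs, hin⟩ := S.mem_Hminus_iff.1 hm
      rw [hP] at hs hin
      rwa [(S.C m).tangent_eq_of_bdry_eq (hσ₂x.trans hs.symm)]
    filter_upwards [nhdsWithin_le_nhds h1, nhdsWithin_le_nhds hT₂σ, self_mem_nhdsWithin]
      with y h2 h3 h4
    exact S.mem_Hminus_iff.2 ⟨h4.1, σ₂ y, h3.symm, h2⟩
  set Q : Phase → Phase := fun x => freeFlow (T₂ (G x)) (G x) with hQ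
  have hQd : DifferentiableAt ℝ Q x := by
    have h1 : ContDiff ℝ 1 fun z : Phase × ℝ => freeFlow z.2 z.1 := by
      unfold freeFlow; fun_prop
    have h2 : DifferentiableAt ℝ (fun z : Phase × ℝ => freeFlow z.2 z.1) (G x, T₂ (G x)) :=
      h1.differentiable (by norm_num) _
    exact h2.comp (f := fun x => (G x, T₂ (G x))) x (hGd.prodMk (hT₂d.comp x hGd))
  -- The domain is a neighbourhood of `x` relative to `Hminus`, and the Poincaré map agrees there
  -- with a map `Q` differentiable at `x` in the full phase space.
  have hU : ∀ᶠ x' in 𝓝[S.Hminus l] x, x' ∈ S.Uminus l ∧ S.poincare l x' = Q x' := by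
    filter_upwards [hGe, hGplus, hGt.eventually hT₂e, hGt.eventually hQm, self_mem_nhdsWithin]
      with x' h1 h2 h3 h4 h5
    have h6 : S.poincareExt (G x') = Q x' := by
      simp only [poincareExt, h3.csInf_eq, hQ]
    refine ⟨⟨h5, ?_⟩, by rw [poincare, h1, h6]⟩
    rw [h1]
    exact ⟨h2, ⟨_, h3.1⟩, m, by rw [h6]; exact h4⟩
  have hsub : S.Uminus l ⊆ S.Hminus l := fun z hz => hz.1
  have hPQ : S.poincare l =ᶠ[𝓝[S.Uminus l] x] Q :=
    nhdsWithin_mono x hsub (hU.mono fun z hz => hz.2)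
  refine ⟨hQd.differentiableWithinAt.congr_of_eventuallyEq hPQ hP, ?_⟩
  intro D hD s s₂ s₃ a c hs hs₂ hs₃
  set V : ℝ → Plane := fun ε => Real.cos (c * ε) • x.2 + Real.sin (c * ε) • rotJ x.2 with hV
  -- A curve in `Hminus` with the prescribed velocity. It stays in the domain near `0`, so every
  -- derivative within the domain takes the same value on this tangent vector, however it acts on
  -- other directions.
  set ξ : ℝ → Phase := fun ε => ((S.C l).bdry (s + a * ε), V ε) with hξ
  have hV0 : V 0 = x.2 := by simp [hV]
  have hξ0 : ξ 0 = x := by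
    simp only [hξ, hV0, mul_zero, add_zero, hs]
  have hlin : ∀ r : ℝ, HasDerivAt (fun ε => r * ε) r 0 := fun r => by
    simpa using (hasDerivAt_id (0 : ℝ)).const_mul r
  have hVd : HasDerivAt V (c • rotJ x.2) 0 := by
    have := ((hlin c).cos.smul_const x.2).fun_add ((hlin c).sin.smul_const (rotJ x.2))
    refine this.congr_deriv ?_
    simp
  have hAd : HasDerivAt (fun ε => (S.C l).bdry (s + a * ε)) (a • (S.C l).tangent s) 0 := by
    have h1 : HasDerivAt (S.C l).bdry ((S.C l).tangent s) (s + a * 0) := by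
      rw [mul_zero, add_zero]; exact (S.C l).hasDerivAt_bdry s
    exact h1.scomp (0 : ℝ) ((hlin a).const_add s)
  have hξd : HasDerivAt ξ (a • (S.C l).tangent s, c • rotJ x.2) 0 := hAd.prodMk hVd
  have hξt : Tendsto ξ (𝓝 0) (𝓝[S.Hminus l] x) := by
    refine tendsto_nhdsWithin_iff.2 ⟨by have := hξd.continuousAt.tendsto; rwa [hξ0] at this, ?_⟩
    have hc : ContinuousAt (fun ε =>
        (inner ℝ (rotJ ((S.C l).tangent (s + a * ε))) (V ε) : ℝ)) 0 := by
      have h1 : Continuous fun ε => rotJ ((S.C l).tangent (s + a * ε)) :=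
        (S.C l).continuous_normal.comp (by fun_prop)
      exact h1.continuousAt.inner hVd.continuousAt
    have h2 : ∀ᶠ ε in 𝓝 (0 : ℝ),
        0 < (inner ℝ (rotJ ((S.C l).tangent (s + a * ε))) (V ε) : ℝ) := by
      refine hc.tendsto.eventually_const_lt ?_
      obtain ⟨-, s', hs', hin⟩ := S.mem_Hminus_iff.1 hxm
      rw [hV0, mul_zero, add_zero]
      rwa [(S.C l).tangent_eq_of_bdry_eq (hs.trans hs'.symm)]
    filter_upwards [h2] with ε hε
    refine S.mem_Hminus_iff.2 ⟨?_, s + a * ε, rfl, hε⟩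
    have h3 : V ε = (larmorFlow c ε x).2 := rfl
    change ‖V ε‖ = 1
    rw [h3, norm_larmorFlow_snd]; exact hxm.1
  have hcomp : ∀ {F : Type} [NormedAddCommGroup F] [NormedSpace ℝ F] {f : Phase → F},
      DifferentiableAt ℝ f x → ∃ f', HasDerivAt (fun ε => f (ξ ε)) f' 0 := by
    intro F _ _ f hf
    rw [← hξ0] at hf
    exact ⟨_, hf.hasFDerivAt.comp_hasDerivAt 0 hξd⟩
  obtain ⟨t', ht'⟩ := hcomp hTd
  obtain ⟨σ', hσ'⟩ := hcomp hσd
  obtain ⟨τ', hτ'⟩ := hcomp (f := fun x => T₂ (G x)) (hT₂d.comp x hGd)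
  obtain ⟨σ₃', hσ₃'⟩ := hcomp (f := fun x => σ₂ (G x)) (hσ₂d.comp x hGd)
  set φ := S.b l * S.exitTime l x with hφ
  have hφ' : HasDerivAt (fun ε => S.b l * T (ξ ε)) (S.b l * t') 0 := ht'.const_mul _
  have hφ0 : S.b l * T (ξ 0) = φ := by rw [hξ0, hT]
  set v₂ := (S.poincareInt l x).2 with hv₂
  have hv₂e : v₂ = Real.cos φ • x.2 + Real.sin φ • rotJ x.2 := rfl
  have hJV : HasDerivAt (fun ε => rotJ (V ε)) (c • rotJ (rotJ x.2)) 0 := by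
    have := rotL.hasFDerivAt.comp_hasDerivAt 0 hVd
    simpa [Function.comp_def, rotJ_smul] using this
  -- The exit direction rotates at the rate `c` of the initial direction plus `b t'` from the change
  -- of the exit time; the free flight keeps it.
  have hV2 : HasDerivAt (fun ε => (G (ξ ε)).2) ((c + S.b l * t') • rotJ v₂) 0 := by
    have h1 := (hφ'.cos.fun_smul hVd).fun_add (hφ'.sin.fun_smul hJV)
    rw [hφ0, hV0] at h1
    refine h1.congr_deriv ?_
    rw [hv₂e, rotJ_add, rotJ_smul, rotJ_smul, rotJ_rotJ]
    module
  have hq2 : HasDerivAt (fun ε => (G (ξ ε)).1) (a • (S.C l).tangent s + t' • v₂ +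
      ((S.b l)⁻¹ * c) • (Real.sin φ • rotJ x.2 - (1 - Real.cos φ) • x.2)) 0 := by
    have h1 := hAd.fun_add (((hφ'.sin.fun_smul hVd).fun_add
      ((hφ'.cos.const_sub 1).fun_smul hJV)).fun_const_smul (S.b l)⁻¹)
    rw [hφ0, hV0] at h1
    refine h1.congr_deriv ?_
    rw [hv₂e, rotJ_rotJ]
    match_scalars <;> (field_simp; try ring)
  have hξx : Tendsto ξ (𝓝 0) (𝓝 x) := hξt.mono_right nhdsWithin_le_nhds
  have htan₂ : (S.C l).tangent (σ x) = (S.C l).tangent s₂ :=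
    (S.C l).tangent_eq_of_bdry_eq (by rw [hσx, hs₂, hGx])
  have htan₃ : (S.C m).tangent (σ₂ (G x)) = (S.C m).tangent s₃ :=
    (S.C m).tangent_eq_of_bdry_eq (by rw [hσ₂x, hs₃, hP])
  have hq2' : HasDerivAt (fun ε => (G (ξ ε)).1) (σ' • (S.C l).tangent s₂) 0 := by
    have h1 : HasDerivAt (S.C l).bdry ((S.C l).tangent s₂) (σ (ξ 0)) := by
      rw [hξ0, ← htan₂]; exact (S.C l).hasDerivAt_bdry _
    exact (h1.scomp (0 : ℝ) hσ').congr_of_eventuallyEq (hξx.eventually hTσ)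
  have hq3 : HasDerivAt (fun ε => (Q (ξ ε)).1) (σ' • (S.C l).tangent s₂ +
      (T₂ (G x) • ((c + S.b l * t') • rotJ v₂) + τ' • v₂)) 0 := by
    have h1 := hq2'.fun_add (hτ'.fun_smul hV2)
    simp only [hξ0, hGx] at h1
    rw [hGx]
    exact h1
  have hq3' : HasDerivAt (fun ε => (Q (ξ ε)).1) (σ₃' • (S.C m).tangent s₃) 0 := by
    have h1 : HasDerivAt (S.C m).bdry ((S.C m).tangent s₃) (σ₂ (G (ξ 0))) := by
      rw [hξ0, ← htan₃]; exact (S.C m).hasDerivAt_bdry _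
    exact (h1.scomp (0 : ℝ) hσ₃').congr_of_eventuallyEq
      (hξx.eventually (hGd.continuousAt.eventually hT₂σ))
  refine ⟨t', σ', τ', σ₃', hq2.unique hq2', ?_, ?_⟩
  · rw [← hq3.unique hq3', hT₂, hGx, mul_smul]; abel
  · have h1 : HasDerivAt (fun ε => Q (ξ ε))
        (σ₃' • (S.C m).tangent s₃, (c + S.b l * t') • rotJ v₂) 0 := hq3'.prodMk hV2
    have hUξ : ∀ᶠ ε in 𝓝 (0 : ℝ), ξ ε ∈ S.Uminus l ∧ S.poincare l (ξ ε) = Q (ξ ε) :=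
      hξt.eventually hU
    rw [← hξ0] at hD
    have h2 : HasDerivWithinAt (S.poincare l ∘ ξ) (D (a • (S.C l).tangent s, c • rotJ x.2))
        (ξ ⁻¹' S.Uminus l) 0 :=
      hD.comp_hasDerivWithinAt 0 hξd.hasDerivWithinAt (mapsTo_preimage _ _)
    have h3 : HasDerivAt (S.poincare l ∘ ξ) (D (a • (S.C l).tangent s, c • rotJ x.2)) 0 :=
      h2.hasDerivAt (hUξ.mono fun ε h => h.1)
    exact h3.unique (h1.congr_of_eventuallyEq (hUξ.mono fun ε h => h.2))

end MagneticBumps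

/-! ### The matrix of the linearized map -/

/-- After division by the denominators of the matrix entries this makes the determinant equal to
one: the map preserves area in the coordinates `(J, J')`. -/
theorem transfer_determinant {N₁ N₂ M₁ M₂ E δ q u : ℝ} (h : M₁ * M₂ + u * E = N₁ * -N₂) :
    (-N₂ * M₁ + q * E) * (N₁ * M₂ + δ * E) -
      (-N₂ * (δ * M₁ - u * N₁) + q * (δ * E + N₁ * M₂)) * E = (N₁ * -N₂) ^ 2 := by
  linear_combination (N₁ * -N₂) * h

/-- The relations between the components of a tangent vector at entry, of its image at exit and of
the velocities, solved for the image. -/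
theorem transfer_relations {e A B β b N₁ P₁ N₂ P₂ a c t σ : ℝ} (hβ : β ≠ 0) (he : e ^ 2 = 1)
    (heb : e * β = b)
    (h₁ : -(σ * N₂) = a * (-(2 * e * A * B * P₁) - (B ^ 2 - A ^ 2) * N₁) +
      b⁻¹ * c * (2 * e * A * B))
    (h₂ : σ * P₂ = a * ((B ^ 2 - A ^ 2) * P₁ - 2 * e * A * B * N₁) + t +
      b⁻¹ * c * (1 - (B ^ 2 - A ^ 2))) :
    β * N₁ * -(σ * N₂) = β * (a * N₁) * ((A ^ 2 - B ^ 2) * N₁ - 2 * e * A * B * P₁) +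
        c * N₁ * (2 * A * B) ∧
      N₁ * N₂ * (c + b * t) = N₁ * c * ((B ^ 2 - A ^ 2) * N₂ - 2 * e * A * B * P₂) +
        β * (-(a * N₁)) * (-(2 * A * B) * (N₁ * N₂ + P₁ * P₂) +
          e * (A ^ 2 - B ^ 2) * (N₁ * P₂ - P₁ * N₂)) := by
  have hinv : b⁻¹ = e / β := by
    refine inv_eq_of_mul_eq_one_right ?_
    rw [← heb]; field_simp; exact he
  rw [hinv] at h₁ h₂
  field_simp at h₁ h₂
  constructor
  · linear_combination N₁ * h₁ + N₁ * c * 2 * A * B * he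
  · subst heb
    linear_combination (-(N₁ * N₂ * e)) * h₂ - N₁ * P₂ * e * h₁ -
      (N₁ * N₂ * c * (1 - (B ^ 2 - A ^ 2)) + 2 * N₁ * c * e * A * B * P₂ -
        2 * N₁ * β * a * A * B * (P₁ * P₂ + N₁ * N₂)) * he

namespace MagneticBumps

variable {n : ℕ} (S : MagneticBumps n)

/-- In terms of the angles at the chord from the point of entry to the point of exit, whose sines
and cosines are determined by the components of the velocities, the curvature bound controls the
angles between the chord and the boundary. -/
theorem chord_angles {l : Fin n} {x : Phase} (hx : x ∈ S.Hminus l)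
    (hy : S.poincareInt l x ∈ S.Hplus l) {s₁ s₂ : ℝ} (hs₁ : (S.C l).bdry s₁ = x.1)
    (hs₂ : (S.C l).bdry s₂ = (S.poincareInt l x).1) {P₁ N₁ P₂ N₂ : ℝ}
    (hP₁ : P₁ = inner ℝ ((S.C l).tangent s₁) x.2)
    (hN₁ : N₁ = inner ℝ (rotJ ((S.C l).tangent s₁)) x.2)
    (hP₂ : P₂ = inner ℝ ((S.C l).tangent s₂) (S.poincareInt l x).2)
    (hN₂ : N₂ = inner ℝ (rotJ ((S.C l).tangent s₂)) (S.poincareInt l x).2) :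
    ∃ e A B : ℝ, e ^ 2 = 1 ∧ e * |S.b l| = S.b l ∧ A ^ 2 + B ^ 2 = 1 ∧ 0 < A ∧
      Real.sin (S.b l * S.exitTime l x) = 2 * e * A * B ∧
      Real.cos (S.b l * S.exitTime l x) = B ^ 2 - A ^ 2 ∧
      0 ≤ B * N₁ + e * A * P₁ ∧ 0 ≤ -(B * N₂) + e * A * P₂ ∧
      B * N₁ + e * A * P₁ ≤ (S.C l).maxCurvature / |S.b l| * A ∧
      -(B * N₂) + e * A * P₂ ≤ (S.C l).maxCurvature / |S.b l| * A ∧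
      (StrictConvex ℝ (S.C l).carrier → 0 < B * N₁ + e * A * P₁) := by
  obtain ⟨e, A, B, he, heb, hAB, hA, hsin, hcos, hch⟩ := S.exists_chord hx hy
  have hβ := abs_pos.2 (S.b_ne_zero l)
  set β := |S.b l|
  set L := 2 * A / β with hL
  have hLpos : 0 < L := by positivity
  have hv := Plane.norm_sq_eq x.2
  rw [hx.1] at hv
  have hv₂ : (S.poincareInt l x).2 = (B ^ 2 - A ^ 2) • x.2 + (2 * e * A * B) • rotJ x.2 := by
    rw [← hsin, ← hcos]; rfl
  -- Height over chord length `L` is the sine of the angle between chord and tangent, so supporting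
  -- lines give its sign and inscribed disks its upper bound.
  have h1 : (S.C l).height s₁ ((S.C l).bdry s₂) = L * (B * N₁ + e * A * P₁) := by
    rw [Bump.height, hs₁, hs₂, hch, hN₁, hP₁, real_inner_smul_right, inner_add_right,
      real_inner_smul_right, real_inner_smul_right, inner_rotJ_rotJ]
  have h2 : (S.C l).height s₂ ((S.C l).bdry s₁) = L * (-(B * N₂) + e * A * P₂) := by
    rw [Bump.height, hs₁, hs₂, ← neg_sub, hch, hN₂, hP₂, hv₂, inner_neg_right]
    simp only [Plane.inner_eq, PiLp.add_apply, PiLp.smul_apply, smul_eq_mul, rotJ_apply_zero,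
      rotJ_apply_one]
    set T0 := (S.C l).tangent s₂ 0
    set T1 := (S.C l).tangent s₂ 1
    linear_combination (-L * (B * (-T1 * x.2 0 + T0 * x.2 1) +
      e * A * (T0 * x.2 0 + T1 * x.2 1))) * (-hAB) +
      L * 2 * A ^ 2 * B * (T0 * x.2 1 - T1 * x.2 0) * he
  have hLsq : ‖(S.C l).bdry s₂ - (S.C l).bdry s₁‖ ^ 2 = L ^ 2 := by
    rw [hs₁, hs₂, hch, norm_smul, mul_pow, Real.norm_eq_abs, sq_abs]
    have : ‖B • x.2 + (e * A) • rotJ x.2‖ ^ 2 = 1 := by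
      rw [Plane.norm_sq_eq]
      simp only [PiLp.add_apply, PiLp.smul_apply, smul_eq_mul, rotJ_apply_zero, rotJ_apply_one]
      linear_combination (-B ^ 2 - e ^ 2 * A ^ 2) * hv + A ^ 2 * he + hAB
    rw [this, mul_one]
  have hLA : (S.C l).maxCurvature * L ^ 2 = 2 * L * ((S.C l).maxCurvature / β * A) := by
    rw [hL]; field_simp
  refine ⟨e, A, B, he, heb, hAB, hA, hsin, hcos, ?_, ?_, ?_, ?_, fun hstrict => ?_⟩
  · have := (S.C l).height_nonneg ((S.C l).bdry_mem s₂) s₁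
    rw [h1] at this
    exact nonneg_of_mul_nonneg_right this hLpos
  · have := (S.C l).height_nonneg ((S.C l).bdry_mem s₁) s₂
    rw [h2] at this
    exact nonneg_of_mul_nonneg_right this hLpos
  · have := (S.C l).two_mul_height_le s₂ s₁
    rw [h1, hLsq, hLA] at this
    refine le_of_mul_le_mul_left ?_ hLpos
    linarith
  · have := (S.C l).two_mul_height_le s₁ s₂
    rw [h2, norm_sub_rev, hLsq, hLA] at this
    refine le_of_mul_le_mul_left ?_ hLpos
    linarith
  · have hne : (S.C l).bdry s₁ ≠ (S.C l).bdry s₂ := fun h => by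
      rw [h, sub_self, norm_zero] at hLsq
      have := pow_pos hLpos 2
      linarith
    -- Strict convexity puts the midpoint of the chord into the interior, so the chord leaves the
    -- tangent line.
    have hmid := hstrict ((S.C l).bdry_mem s₁) ((S.C l).bdry_mem s₂) hne
      (by norm_num : (0 : ℝ) < 1 / 2) (by norm_num : (0 : ℝ) < 1 / 2) (by norm_num)
    have h3 := (S.C l).height_pos_of_mem_interior hmid s₁
    have h4 : (1 / 2 : ℝ) • (S.C l).bdry s₁ + (1 / 2 : ℝ) • (S.C l).bdry s₂ =
        (S.C l).bdry s₁ + (1 / 2 : ℝ) • ((S.C l).bdry s₂ - (S.C l).bdry s₁) := by module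
    rw [h4, Bump.height_add_smul, Bump.height_bdry_self] at h3
    change 0 < 0 + 1 / 2 * (S.C l).height s₁ ((S.C l).bdry s₂) at h3
    rw [h1] at h3
    exact (pos_iff_pos_of_mul_pos (by linarith)).1 hLpos

/-- The length of the free flight compared with the distance between the bumps. -/
theorem flight_estimate (hn : 2 ≤ n) {l m : Fin n} (hlm : m ≠ l) {R τ s₂ : ℝ} {v z : Plane}
    (hR : 0 < R) (hRk : R * (S.C l).maxCurvature ≤ 1) (hv : ‖v‖ = 1) (hτ : 0 < τ)
    (hz : z = (S.C l).bdry s₂ + τ • v) (hzm : z ∈ (S.C m).carrier) :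
    max (S.d l) (S.d m) ≤ τ ∧ (R + max (S.d l) (S.d m)) ^ 2 ≤
      R ^ 2 - 2 * R * τ * inner ℝ (rotJ ((S.C l).tangent s₂)) v + τ ^ 2 := by
  set D := max (S.d l) (S.d m) with hD
  have hDpos : 0 < D := (S.d_pos hn l).trans_le (le_max_left _ _)
  have hdist : ∀ y ∈ (S.C l).carrier, D ≤ dist y z := fun y hy =>
    max_le (S.d_le_dist hlm hy hzm) (by rw [dist_comm]; exact S.d_le_dist hlm.symm hzm hy)
  constructor
  · have := hdist _ ((S.C l).bdry_mem s₂)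
    rwa [hz, dist_eq_norm, ← norm_neg, neg_sub, add_sub_cancel_left, norm_smul, hv, mul_one,
      Real.norm_of_nonneg hτ.le] at this
  · set c := (S.C l).bdry s₂ + R • rotJ ((S.C l).tangent s₂) with hc
    have hball := (S.C l).closedBall_subset hR.le hRk s₂
    have hfar : R < ‖z - c‖ := by
      by_contra hcon
      push Not at hcon
      have := hdist z (hball (by rwa [Metric.mem_closedBall, dist_eq_norm]))
      rw [dist_self] at this
      linarith
    have hpos : 0 < ‖z - c‖ := hR.trans hfar
    -- The point of the inscribed disk nearest to `z` belongs to bump `l`, hence is at distance at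
    -- least `D` from `z`; so `z` is at distance at least `R + D` from the centre.
    have hg : c + (R / ‖z - c‖) • (z - c) ∈ (S.C l).carrier := hball (by
      rw [Metric.mem_closedBall, dist_eq_norm, add_sub_cancel_left, norm_smul,
        Real.norm_of_nonneg (by positivity), div_mul_cancel₀ _ hpos.ne'])
    have h1 := hdist _ hg
    have h2 : z - (c + (R / ‖z - c‖) • (z - c)) = (1 - R / ‖z - c‖) • (z - c) := by module
    rw [dist_comm, dist_eq_norm, h2, norm_smul, Real.norm_of_nonneg
      (by rw [sub_nonneg, div_le_one hpos]; exact hfar.le), sub_mul, one_mul,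
      div_mul_cancel₀ _ hpos.ne'] at h1
    have h3 : (R + D) ^ 2 ≤ ‖z - c‖ ^ 2 := pow_le_pow_left₀ (by positivity) (by linarith) 2
    have h4 : z - c = τ • v - R • rotJ ((S.C l).tangent s₂) := by rw [hz, hc]; abel
    rw [h4, norm_sub_sq_real, norm_smul, norm_smul, norm_rotJ, (S.C l).norm_tangent, hv,
      real_inner_smul_left, real_inner_smul_right, real_inner_comm, Real.norm_of_nonneg hτ.le,
      Real.norm_of_nonneg hR.le] at h3
    linarith

theorem mem_tangentH_iff {l : Fin n} {x w : Phase} {s : ℝ} (hs : (S.C l).bdry s = x.1) :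
    w ∈ S.tangentH l x ↔ ∃ a c : ℝ, w = (a • (S.C l).tangent s, c • rotJ x.2) := by
  constructor
  · rintro ⟨s', a, c, hs', rfl⟩
    exact ⟨a, c, by rw [(S.C l).tangent_eq_of_bdry_eq (hs.trans hs'.symm)]; rfl⟩
  · rintro ⟨a, c, rfl⟩
    exact ⟨s, a, c, hs, rfl⟩

theorem jacobiCoord_eq {x : Phase} (hx : ‖x.2‖ = 1) (u : Plane) (c : ℝ) :
    jacobiCoord x (u, c • rotJ x.2) = (inner ℝ (rotJ x.2) u, c) := by
  simp only [jacobiCoord, real_inner_smul_right, real_inner_self_eq_norm_sq, norm_rotJ, hx]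
  norm_num

/-- The matrix, up to sign, of the linearized Poincaré map with respect to the vectors that span
the cones. -/
theorem exists_matrix (hn : 2 ≤ n) (hline : S.NoThreeOnLine) (hstrong : S.VeryStrong)
    {l m : Fin n} {x : Phase} (hx : x ∈ S.Uminus l) (hm : S.poincare l x ∈ S.Hminus m) :
    ∃ x₁ x₂ y₁ y₂ : ℝ, 0 < x₁ ∧ 0 < x₂ ∧ 0 ≤ y₁ ∧ 0 < y₂ ∧ 0 < x₁ * y₂ - x₂ * y₁ ∧
      (StrictConvex ℝ (S.C l).carrier → 0 < y₁) ∧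
      ∀ D : Phase →L[ℝ] Phase, HasFDerivWithinAt (S.poincare l) D (S.Uminus l) x →
        ∀ w ∈ S.tangentH l x, ∀ p r : ℝ,
          jacobiCoord x w = p • ((1, 0) : ℝ × ℝ) + r • ((S.d l, 1) : ℝ × ℝ) →
          D w ∈ S.tangentH m (S.poincare l x) ∧ jacobiCoord (S.poincare l x) (D w) =
            (-(p * x₁ + r * x₂)) • ((1, 0) : ℝ × ℝ) +
              (-(p * y₁ + r * y₂)) • ((S.d m, 1) : ℝ × ℝ) := by
  have hderiv := (S.poincare_deriv hx hm).2
  obtain ⟨hxm, hy, hne, -⟩ := hx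
  obtain ⟨-, s₁, hs₁, hin⟩ := S.mem_Hminus_iff.1 hxm
  obtain ⟨hv₂n, s₂, hs₂, hout⟩ := S.mem_Hplus_iff.1 hy
  obtain ⟨-, s₃, hs₃, -⟩ := S.mem_Hminus_iff.1 hm
  set v₂ := (S.poincareInt l x).2 with hv₂
  set τ := sInf (S.hitTimes (S.poincareInt l x)) with hτ
  have hleast := S.isLeast_hitTimes hy hne
  have hτ0 : 0 < τ := hleast.1.1
  have hzeq : (S.poincare l x).1 = (S.C l).bdry s₂ + τ • v₂ := by rw [hs₂]; rfl
  have hz2 : (S.poincare l x).2 = v₂ := rfl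
  have hzm : (S.poincare l x).1 ∈ (S.C m).carrier := hs₃ ▸ (S.C m).bdry_mem s₃
  have hml : m ≠ l := by
    rintro rfl
    exact S.freeFlow_notMem hy hτ0 hzm
  obtain ⟨P₁, hP₁⟩ : ∃ P, P = (inner ℝ ((S.C l).tangent s₁) x.2 : ℝ) := ⟨_, rfl⟩
  obtain ⟨N₁, hN₁⟩ : ∃ N, N = (inner ℝ (rotJ ((S.C l).tangent s₁)) x.2 : ℝ) := ⟨_, rfl⟩
  obtain ⟨P₂, hP₂⟩ : ∃ P, P = (inner ℝ ((S.C l).tangent s₂) v₂ : ℝ) := ⟨_, rfl⟩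
  obtain ⟨N₂, hN₂⟩ : ∃ N, N = (inner ℝ (rotJ ((S.C l).tangent s₂)) v₂ : ℝ) := ⟨_, rfl⟩
  obtain ⟨e, A, B, he, heb, hAB, hA, hsin, hcos, hS₁, hS₂, hS₁k, hS₂k, hS₁p⟩ :=
    S.chord_angles hxm hy hs₁ hs₂ hP₁ hN₁ hP₂ hN₂
  rw [← hN₁] at hin
  rw [← hN₂] at hout
  have hβ := abs_pos.2 (S.b_ne_zero l)
  set β := |S.b l| with hβdef
  set κ := (S.C l).maxCurvature with hκ
  have hκ0 : 0 < κ := (S.C l).maxCurvature_pos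
  have h3 := hstrong.three_lt hn hline l
  have hd := S.d_pos hn l
  -- `0.954` is a rational lower bound for `3 / π`.
  have hdκ : 954 / 1000 < S.d l * (β - 2 * κ) := by
    by_contra hcon
    push Not at hcon
    have h4 := mul_le_mul_of_nonneg_left hcon Real.pi_pos.le
    have h5 := Real.pi_lt_d4
    linarith
  have hβκ : 2 * κ < β := by
    have : 0 < β - 2 * κ := (pos_iff_pos_of_mul_pos (by linarith)).1 hd
    linarith
  have hk : κ / β < 1 / 2 := by rw [div_lt_iff₀ hβ]; linarith
  have hunit : ∀ {s : ℝ} {v : Plane}, ‖v‖ = 1 → (inner ℝ (rotJ ((S.C l).tangent s)) v : ℝ) ^ 2 +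
      (inner ℝ ((S.C l).tangent s) v : ℝ) ^ 2 = 1 := fun {s v} hv => by
    have h1 := Plane.norm_sq_eq v
    have h2 := Plane.norm_sq_eq ((S.C l).tangent s)
    rw [hv] at h1
    rw [(S.C l).norm_tangent] at h2
    simp only [Plane.inner_eq, rotJ_apply_zero, rotJ_apply_one]
    linear_combination (-(v 0 ^ 2 + v 1 ^ 2)) * h2 - h1
  have hu₁ : N₁ ^ 2 + P₁ ^ 2 = 1 := by rw [hN₁, hP₁]; exact hunit hxm.1
  have hu₂ : N₂ ^ 2 + P₂ ^ 2 = 1 := by rw [hN₂, hP₂]; exact hunit hv₂n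
  -- Sines and cosines of the angles between chord and boundary; `A`, `B` are those of half the
  -- turning angle, and `N₁`, `-N₂` are the sines of the sums.
  obtain ⟨S₁, hS₁e⟩ : ∃ S₁, S₁ = B * N₁ + e * A * P₁ := ⟨_, rfl⟩
  obtain ⟨S₂, hS₂e⟩ : ∃ S₂, S₂ = -(B * N₂) + e * A * P₂ := ⟨_, rfl⟩
  obtain ⟨C₁, hC₁e⟩ : ∃ C₁, C₁ = A * N₁ - e * B * P₁ := ⟨_, rfl⟩
  obtain ⟨C₂, hC₂e⟩ : ∃ C₂, C₂ = -(A * N₂) - e * B * P₂ := ⟨_, rfl⟩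
  rw [← hS₁e] at hS₁ hS₁k hS₁p
  rw [← hS₂e] at hS₂ hS₂k
  have hSC₁ : S₁ ^ 2 + C₁ ^ 2 = 1 := by
    rw [hS₁e, hC₁e]
    linear_combination (N₁ ^ 2 + e ^ 2 * P₁ ^ 2) * hAB + P₁ ^ 2 * he + hu₁
  have hSC₂ : S₂ ^ 2 + C₂ ^ 2 = 1 := by
    rw [hS₂e, hC₂e]
    linear_combination (N₂ ^ 2 + e ^ 2 * P₂ ^ 2) * hAB + P₂ ^ 2 * he + hu₂
  have hp₁ : A * C₁ + B * S₁ = N₁ := by rw [hS₁e, hC₁e]; linear_combination N₁ * hAB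
  have hp₂ : A * C₂ + B * S₂ = -N₂ := by rw [hS₂e, hC₂e]; linear_combination -N₂ * hAB
  have hkA : κ / β * A < A := by nlinarith
  have hp₁' : 0 < A * C₁ + B * S₁ := by rw [hp₁]; exact hin
  have hp₂' : 0 < A * C₂ + B * S₂ := by rw [hp₂]; linarith
  obtain ⟨hC₁, -, hm₁⟩ := acute_of_sin_lt hAB hSC₁ hS₁ (hS₁k.trans_lt hkA) hp₁'
  obtain ⟨hC₂, -, hm₂⟩ := acute_of_sin_lt hAB hSC₂ hS₂ (hS₂k.trans_lt hkA) hp₂'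
  -- `β > 2κ` admits an inscribed disk of twice the Larmor radius.
  obtain ⟨hΔτ, hball⟩ := S.flight_estimate hn hml (R := 2 / β) (by positivity)
    (by rw [div_mul_eq_mul_div, div_le_one hβ]; exact hβκ.le) hv₂n hτ0 hzeq hzm
  rw [← hN₂] at hball
  set Δ := max (S.d l) (S.d m) with hΔ
  have hest := cone_estimate (δ := β * S.d l) (Δ := β * Δ) (δm := β * S.d m) (t := β * τ)
    hAB hSC₁ hSC₂ hA hS₁ hS₂ hk hS₁k hS₂k hp₁' hp₂'
    (by
      have : β * S.d l * (1 - 2 * (κ / β)) = S.d l * (β - 2 * κ) := by field_simp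
      rwa [this])
    (by gcongr; exact le_max_left _ _) (by gcongr; exact le_max_right _ _) (by gcongr)
    (by
      rw [hp₂]
      have h4 := mul_le_mul_of_nonneg_left hball (sq_nonneg β)
      have e1 : β ^ 2 * (2 / β + Δ) ^ 2 = (β * Δ + 2) ^ 2 := by field_simp; ring
      have e2 : β ^ 2 * ((2 / β) ^ 2 - 2 * (2 / β) * τ * N₂ + τ ^ 2) =
          4 + 4 * (β * τ) * -N₂ + (β * τ) ^ 2 := by field_simp; ring
      rwa [e1, e2] at h4)
  obtain ⟨M₁, hM₁⟩ : ∃ M, M = A * C₁ - B * S₁ := ⟨_, rfl⟩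
  obtain ⟨M₂, hM₂⟩ : ∃ M, M = A * C₂ - B * S₂ := ⟨_, rfl⟩
  obtain ⟨E, hE⟩ : ∃ E, E = S₁ * C₂ + C₁ * S₂ := ⟨_, rfl⟩
  rw [hp₁, hp₂, ← hM₁, ← hM₂, ← hE] at hest
  rw [← hM₁] at hm₁
  rw [← hM₂] at hm₂
  have hE0 : 0 ≤ E := by rw [hE]; positivity
  have hdm : S.d m ≤ τ := (le_max_right _ _).trans hΔτ
  have hN₂0 : 0 < -N₂ := neg_pos.2 hout
  have hK : 0 < N₁ * -N₂ := mul_pos hin hN₂0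
  have hX₁ : 0 < -N₂ * M₁ + (β * τ - β * S.d m) * E :=
    add_pos_of_pos_of_nonneg (mul_pos hN₂0 hm₁)
      (mul_nonneg (by rw [← mul_sub]; exact mul_nonneg hβ.le (by linarith)) hE0)
  have hB₂ : 0 < N₁ * M₂ + β * S.d l * E :=
    add_pos_of_pos_of_nonneg (mul_pos hin hm₂) (mul_nonneg (mul_pos hβ hd).le hE0)
  have hdet := transfer_determinant (N₁ := N₁) (N₂ := N₂) (M₁ := M₁) (M₂ := M₂) (E := E)
    (δ := β * S.d l) (q := β * τ - β * S.d m) (u := 2 * A * B)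
    (by rw [← hp₁, ← hp₂, hM₁, hM₂, hE]; ring)
  refine ⟨(-N₂ * M₁ + (β * τ - β * S.d m) * E) / (N₁ * -N₂),
    (-N₂ * (β * S.d l * M₁ - 2 * A * B * N₁) +
      (β * τ - β * S.d m) * (β * S.d l * E + N₁ * M₂)) / (β * (N₁ * -N₂)),
    β * E / (N₁ * -N₂), (N₁ * M₂ + β * S.d l * E) / (N₁ * -N₂), div_pos hX₁ hK,
    div_pos hest (mul_pos hβ hK), div_nonneg (mul_nonneg hβ.le hE0) hK.le, div_pos hB₂ hK, ?_,
    fun hs => ?_, ?_⟩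
  · generalize -N₂ * M₁ + (β * τ - β * S.d m) * E = X₁ at *
    generalize -N₂ * (β * S.d l * M₁ - 2 * A * B * N₁) +
      (β * τ - β * S.d m) * (β * S.d l * E + N₁ * M₂) = X₂ at *
    generalize N₁ * M₂ + β * S.d l * E = Y₂ at *
    generalize N₁ * -N₂ = K at *
    -- The determinant is one, by area preservation.
    have h1 : X₁ / K * (Y₂ / K) - X₂ / (β * K) * (β * E / K) = 1 := by
      field_simp
      linear_combination hdet
    rw [h1]; exact one_pos
  · refine div_pos (mul_pos hβ ?_) hK
    rw [hE]
    exact add_pos_of_pos_of_nonneg (mul_pos (hS₁p hs) hC₂) (mul_nonneg hC₁.le hS₂)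
  · intro D hD w hw p r hpr
    obtain ⟨a, c, rfl⟩ := (S.mem_tangentH_iff hs₁).1 hw
    obtain ⟨t', σ', τ', σ₃', h1, h2, h4⟩ := hderiv D hD s₁ s₂ s₃ a c hs₁ hs₂ hs₃
    rw [jacobiCoord_eq hxm.1, real_inner_smul_right] at hpr
    simp only [Prod.smul_mk, Prod.mk_add_mk, smul_eq_mul, mul_one, mul_zero, zero_add,
      Prod.mk.injEq] at hpr
    obtain ⟨hJ, hc⟩ := hpr
    subst hc
    rw [inner_rotJ_left, real_inner_comm, ← hN₁] at hJ
    refine ⟨(S.mem_tangentH_iff hs₃).2 ⟨_, _, h4⟩, ?_⟩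
    rw [h4, ← h2]
    have hJ' : jacobiCoord (S.poincare l x) (σ' • (S.C l).tangent s₂ + τ' • v₂ +
        (τ * (c + S.b l * t')) • rotJ v₂, (c + S.b l * t') • rotJ v₂) =
        (-(σ' * N₂) + τ * (c + S.b l * t'), c + S.b l * t') := by
      rw [← hz2, jacobiCoord_eq (x := S.poincare l x) hv₂n, hz2]
      rw [inner_add_right, inner_add_right, real_inner_smul_right, real_inner_smul_right,
        real_inner_smul_right, inner_rotJ_self, real_inner_self_eq_norm_sq, norm_rotJ, hv₂n,
        inner_rotJ_left, real_inner_comm, ← hN₂]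
      congr 1; ring
    rw [hJ']
    simp only [Prod.smul_mk, Prod.mk_add_mk, smul_eq_mul, mul_one, mul_zero, zero_add,
      Prod.mk.injEq]
    set φ := S.b l * S.exitTime l x with hφ
    have hv := Plane.norm_sq_eq x.2
    rw [hxm.1] at hv
    have hv₂e : v₂ = Real.cos φ • x.2 + Real.sin φ • rotJ x.2 := rfl
    have hcs := Real.sin_sq_add_cos_sq φ
    have h10 := congrArg (fun u : Plane => u 0) h1
    have h11 := congrArg (fun u : Plane => u 1) h1
    have hP₂' := hP₂
    have hN₂' := hN₂
    simp only [hv₂e, Plane.inner_eq, PiLp.add_apply, PiLp.sub_apply, PiLp.smul_apply, smul_eq_mul,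
      rotJ_apply_zero, rotJ_apply_one] at h10 h11 hP₂' hN₂' hP₁ hN₁
    -- `hi` and `hii` are the components of the exit condition orthogonal and parallel to the exit
    -- velocity; the first does not contain the variation `t'` of the exit time.
    have hi : -(σ' * N₂) = a * (-(Real.sin φ * P₁) - Real.cos φ * N₁) +
        (S.b l)⁻¹ * c * Real.sin φ := by
      rw [hN₂', hP₁, hN₁]
      linear_combination (Real.cos φ * x.2 1 + Real.sin φ * x.2 0) * h10 -
        (Real.cos φ * x.2 0 - Real.sin φ * x.2 1) * h11 - (S.b l)⁻¹ * c * Real.sin φ * hv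
    have hii : σ' * P₂ = a * (Real.cos φ * P₁ - Real.sin φ * N₁) + t' +
        (S.b l)⁻¹ * c * (1 - Real.cos φ) := by
      rw [hP₂', hP₁, hN₁]
      linear_combination (-(Real.cos φ * x.2 0 - Real.sin φ * x.2 1)) * h10 -
        (Real.cos φ * x.2 1 + Real.sin φ * x.2 0) * h11 +
        (t' + (S.b l)⁻¹ * c) * (x.2 0 ^ 2 + x.2 1 ^ 2) * hcs -
        (t' + (S.b l)⁻¹ * c * (1 - Real.cos φ)) * hv
    rw [hsin, hcos] at hi hii
    obtain ⟨k₁, k₂⟩ := transfer_relations hβ.ne' he heb hi hii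
    have hM₁' : M₁ = (A ^ 2 - B ^ 2) * N₁ - 2 * e * A * B * P₁ := by
      rw [hM₁, hC₁e, hS₁e]; ring
    have hM₂' : M₂ = (B ^ 2 - A ^ 2) * N₂ - 2 * e * A * B * P₂ := by
      rw [hM₂, hC₂e, hS₂e]; ring
    have hE' : E = -(2 * A * B) * (N₁ * N₂ + P₁ * P₂) +
        e * (A ^ 2 - B ^ 2) * (N₁ * P₂ - P₁ * N₂) := by
      rw [hE, hC₁e, hS₁e, hC₂e, hS₂e]
      linear_combination (-(2 * A * B * P₁ * P₂)) * he
    rw [← hM₁'] at k₁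
    rw [← hM₂', ← hE'] at k₂
    have hJ'' : a * N₁ = -(p + c * S.d l) := by linarith
    rw [hJ''] at k₁ k₂
    have hN₁0 := hin.ne'
    have hN₂0' := hout.ne
    have hβ0 := hβ.ne'
    have g₂ : c + S.b l * t' = -(p * (β * E / (N₁ * -N₂)) +
        c * ((N₁ * M₂ + β * S.d l * E) / (N₁ * -N₂))) := by
      generalize c + S.b l * t' = c₂ at *
      field_simp
      linear_combination k₂
    -- This is `J` on leaving the bump; the flight adds `τ` times the new `J'`, and passing to the
    -- basis with `d m` subtracts `d m` times it, so only `τ - d m` remains.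
    have g₁ : -(σ' * N₂) = -(p * (M₁ / N₁) + c * ((β * S.d l * M₁ - 2 * A * B * N₁) / (β * N₁))) := by
      generalize -(σ' * N₂) = J₂ at *
      field_simp
      linear_combination k₁
    refine ⟨?_, g₂⟩
    rw [g₁, g₂]
    field_simp
    ring

end MagneticBumps

/-! ### Tangent planes, coordinates and closed cones -/

namespace MagneticBumps

variable {n : ℕ} (S : MagneticBumps n)

theorem isClosed_tangentH {l : Fin n} {x : Phase} (hx : x ∈ S.Hminus l) :
    IsClosed (S.tangentH l x) := by
  obtain ⟨-, s, hs, -⟩ := S.mem_Hminus_iff.1 hx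
  have : S.tangentH l x =
      (Submodule.span ℝ {((S.C l).tangent s, (0 : Plane)), ((0 : Plane), rotJ x.2)} : Set Phase) := by
    ext w
    rw [S.mem_tangentH_iff hs, SetLike.mem_coe, Submodule.mem_span_pair]
    constructor
    · rintro ⟨a, c, rfl⟩
      exact ⟨a, c, by simp⟩
    · rintro ⟨a, c, rfl⟩
      exact ⟨a, c, by simp⟩
  rw [this]
  exact Submodule.closed_of_finiteDimensional _

theorem continuous_jacobiCoord (x : Phase) : Continuous (jacobiCoord x) := by
  unfold jacobiCoord
  fun_prop

theorem coord_eq (J : ℝ × ℝ) (d : ℝ) :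
    J = (J.1 - d * J.2) • ((1, 0) : ℝ × ℝ) + J.2 • ((d, 1) : ℝ × ℝ) := by
  ext <;> simp
  ring

/-- The tangent plane is a finite-dimensional subspace and the coefficients are continuous in the
vector, so `0 ≤ p * r` on the tangent plane is a closed condition. -/
theorem closure_cone_subset {l : Fin n} {x : Phase} (hx : x ∈ S.Hminus l) :
    closure (S.cone l x) ⊆ {w | w ∈ S.tangentH l x ∧ ∃ p r : ℝ, 0 ≤ p * r ∧
      jacobiCoord x w = p • ((1, 0) : ℝ × ℝ) + r • ((S.d l, 1) : ℝ × ℝ)} := by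
  have hcl : IsClosed {w | 0 ≤ ((jacobiCoord x w).1 - S.d l * (jacobiCoord x w).2) *
      (jacobiCoord x w).2} := by
    have := continuous_jacobiCoord x
    exact isClosed_le continuous_const (by fun_prop)
  have hsub : S.cone l x ⊆ S.tangentH l x ∩ {w | 0 ≤ ((jacobiCoord x w).1 -
      S.d l * (jacobiCoord x w).2) * (jacobiCoord x w).2} := by
    rintro w ⟨hw, p, r, hpr, h⟩
    refine ⟨hw, ?_⟩
    rw [mem_ofPred_eq, h]
    simp only [Prod.smul_mk, Prod.mk_add_mk, smul_eq_mul, mul_one, mul_zero, zero_add]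
    linarith
  intro w hw
  obtain ⟨h1, h2⟩ := closure_minimal hsub ((S.isClosed_tangentH hx).inter hcl) hw
  exact ⟨h1, _, _, h2, coord_eq _ _⟩

/-- A tangent vector is determined by its coordinates. -/
theorem eq_zero_of_jacobiCoord_eq_zero {l : Fin n} {x w : Phase} (hx : x ∈ S.Hminus l)
    (hw : w ∈ S.tangentH l x) (h : jacobiCoord x w = 0) : w = 0 := by
  obtain ⟨hxn, s, hs, hin⟩ := S.mem_Hminus_iff.1 hx
  obtain ⟨a, c, rfl⟩ := (S.mem_tangentH_iff hs).1 hw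
  rw [jacobiCoord_eq hxn, real_inner_smul_right, inner_rotJ_left, real_inner_comm] at h
  obtain ⟨h1, h2⟩ := Prod.mk.inj h
  have ha : a = 0 := (mul_eq_zero.1 h1).resolve_right (neg_ne_zero.2 hin.ne')
  rw [ha, show c = 0 from h2, zero_smul, zero_smul]; rfl

/-- Every pair of coordinates belongs to a tangent vector. -/
theorem exists_mem_tangentH {l : Fin n} {x : Phase} (hx : x ∈ S.Hminus l) (J : ℝ × ℝ) :
    ∃ w ∈ S.tangentH l x, jacobiCoord x w = J := by
  obtain ⟨hxn, s, hs, hin⟩ := S.mem_Hminus_iff.1 hx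
  set N := (inner ℝ (rotJ ((S.C l).tangent s)) x.2 : ℝ) with hN
  refine ⟨_, (S.mem_tangentH_iff hs).2 ⟨-J.1 / N, J.2, rfl⟩, ?_⟩
  rw [jacobiCoord_eq hxn, real_inner_smul_right, inner_rotJ_left, real_inner_comm, ← hN]
  have := hin.ne'
  ext
  · simp only; field_simp
  · rfl

end MagneticBumps

end

/-! ### Invariance of the cones -/

theorem lemma3 {n : ℕ} (hn : 2 ≤ n) (S : MagneticBumps n)
    (hline : S.NoThreeOnLine) (hstrong : S.VeryStrong)
    (l m : Fin n) (x : Phase) (hx : x ∈ S.Uminus l) (hm : S.poincare l x ∈ S.Hminus m) :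
    DifferentiableWithinAt ℝ (S.poincare l) (S.Uminus l) x ∧
      ∀ T : Phase →L[ℝ] Phase, HasFDerivWithinAt (S.poincare l) T (S.Uminus l) x →
        T '' S.cone l x ⊂ S.cone m (S.poincare l x) ∧
        (StrictConvex ℝ (S.C l).carrier →
          T '' (closure (S.cone l x) \ {0}) ⊆ S.cone m (S.poincare l x)) := by
  refine ⟨(S.poincare_deriv hx hm).1, fun T hT => ?_⟩
  obtain ⟨x₁, x₂, y₁, y₂, hx₁, hx₂, hy₁, hy₂, hdet, hstrict, hmat⟩ :=
    S.exists_matrix hn hline hstrong hx hm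
  refine ⟨⟨?_, fun hsub => ?_⟩, fun hsc => ?_⟩
  · rintro _ ⟨w, ⟨hw, p, r, hpr, hJ⟩, rfl⟩
    obtain ⟨h1, h2⟩ := hmat T hT w hw p r hJ
    refine ⟨h1, _, _, ?_, h2⟩
    have e1 : -(p * x₁ + r * x₂) * -(p * y₁ + r * y₂) =
        p ^ 2 * (x₁ * y₁) + p * r * (x₁ * y₂ + x₂ * y₁) + r ^ 2 * (x₂ * y₂) := by ring
    rw [e1]
    have h3 : 0 < p * r * (x₁ * y₂ + x₂ * y₁) :=
      mul_pos hpr (add_pos_of_pos_of_nonneg (mul_pos hx₁ hy₂) (mul_nonneg hx₂.le hy₁))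
    have h4 : 0 ≤ p ^ 2 * (x₁ * y₁) := by positivity
    have h5 : 0 ≤ r ^ 2 * (x₂ * y₂) := by positivity
    linarith
  -- The image of the upper edge has coefficients proportional to `(x₂, y₂)`, and the image cone
  -- lies on the lower side of it because the determinant is positive. Doubling the second
  -- coefficient gives a vector of the target cone beyond that edge.
  · obtain ⟨w', hw', hJ'⟩ := S.exists_mem_tangentH hm
      (x₂ • ((1, 0) : ℝ × ℝ) + (2 * y₂) • ((S.d m, 1) : ℝ × ℝ))
    obtain ⟨w, ⟨hw, p, r, hpr, hJ⟩, rfl⟩ := hsub ⟨hw', x₂, 2 * y₂, by positivity, hJ'⟩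
    obtain ⟨-, h2⟩ := hmat T hT w hw p r hJ
    rw [hJ'] at h2
    simp only [Prod.smul_mk, Prod.mk_add_mk, smul_eq_mul, mul_one, mul_zero, zero_add,
      Prod.mk.injEq] at h2
    obtain ⟨g1, g2⟩ := h2
    rw [g2] at g1
    have g3 : x₂ = -(p * x₁ + r * x₂) := by linarith
    have hp : 0 < p := by
      have : p * (x₁ * y₂ - x₂ * y₁) = x₂ * y₂ := by linear_combination y₂ * g3 - x₂ * g2
      have h3 : 0 < p * (x₁ * y₂ - x₂ * y₁) := by rw [this]; positivity
      exact (pos_iff_pos_of_mul_pos h3).2 hdet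
    have hr : 0 < r := (pos_iff_pos_of_mul_pos hpr).1 hp
    have : 0 ≤ p * y₁ + r * y₂ := by positivity
    linarith
  · have hy₁' := hstrict hsc
    rintro _ ⟨w, ⟨hw, hw0⟩, rfl⟩
    obtain ⟨hwt, p, r, hpr, hJ⟩ := S.closure_cone_subset hx.1 hw
    obtain ⟨h1, h2⟩ := hmat T hT w hwt p r hJ
    refine ⟨h1, _, _, ?_, h2⟩
    have e1 : -(p * x₁ + r * x₂) * -(p * y₁ + r * y₂) =
        p ^ 2 * (x₁ * y₁) + p * r * (x₁ * y₂ + x₂ * y₁) + r ^ 2 * (x₂ * y₂) := by ring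
    rw [e1]
    have h3 : 0 ≤ p * r * (x₁ * y₂ + x₂ * y₁) :=
      mul_nonneg hpr (add_nonneg (mul_pos hx₁ hy₂).le (mul_nonneg hx₂.le hy₁))
    have h4 : 0 ≤ p ^ 2 * (x₁ * y₁) := by positivity
    have h5 : 0 ≤ r ^ 2 * (x₂ * y₂) := by positivity
    -- On the closed cone the mixed term may vanish. One of the two squares is then needed, and that
    -- of `p` is positive only because strict convexity gives `y₁ > 0`.
    by_cases hp : p = 0
    · have hr : r ≠ 0 := by
        rintro rfl
        refine hw0 (S.eq_zero_of_jacobiCoord_eq_zero hx.1 hwt ?_)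
        rw [hJ, hp, zero_smul, zero_smul, add_zero]
      have : 0 < r ^ 2 * (x₂ * y₂) := by positivity
      linarith
    · have : 0 < p ^ 2 * (x₁ * y₁) := by positivity
      linarith
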